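/- Let $n \ge 0$ and let $G \le \mathrm{Sym}(n)$ be a (finite) group of permutations. For $i \ge 0$ let $\mathrm{Conf}_n(\mathbb R^i) \subset (\mathbb R^i)^n$ be the space of $n$-tuples of pairwise distinct points of Euclidean space $\mathbb R^i$, and for $\delta > 0$ put $$E^i = \{(x_1,\dots,x_n) \in \mathrm{Conf}_n(\mathbb R^i) : |x_k| = 1 \text{ for all } k,\ |x_a - x_b| = \delta \text{ for all } a<b\},$$ on which $G$ acts from the right by permuting the labels. The inclusions $\mathbb R^i \subset \mathbb R^{i+1}$, $v \mapsto (v,0)$, induce inclusions $E^i \subset E^{i+1}$; let $EG = \bigcup_i E^i \subset (\mathbb R^\infty)^n$, with the colimit topology, and let $BG = EG/G$ and $B^i = E^i/G$, with the quotient topologies. Then there is $\delta \in (0,1)$ such that the following hold. 1. $EG \to BG$ is a model of the universal $G$-bundle: $EG$ is Hausdorff and contractible, $G$ acts on it continuously and freely, $BG$ is Hausdorff, and $EG \to BG$ is a principal $G$-covering. 2. $E^0 \subset E^1 \subset \dots \subset EG$ is an exhaustive filtration of $EG$ by closed $G$-invariant subspaces, whose colimit topology is the topology of $EG$. Each $E^i$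 is a (possibly empty) compact smooth manifold without boundary, of some dimension $d_i$, smoothly embedded in $(\mathbb R^i)^n$ and in $E^{i+1}$, and $G$ acts on it smoothly and freely. 3. $B^0 \subset B^1 \subset \dots \subset BG$ is an exhaustive filtration of $BG$ by closed subspaces, whose colimit topology is the topology of $BG$. Each $B^i$ is a (possibly empty) compact smooth manifold without boundary, of dimension $d_i$, such that $E^i \to B^i$ is a local diffeomorphism and $B^i$ is smoothly embedded in $B^{i+1}$. -/

import Mathlib

open scoped Manifold ContDiff Topology

noncomputable section

/-- The configuration space `Conf_n(ℝ^i)` of `n` pairwise distinct labelled points of Euclidean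
`i`-space, as an (open) subset of the vector space `(ℝ^i)^n`. -/
def confSpace (n i : ℕ) : Set (Fin n → EuclideanSpace ℝ (Fin i)) :=
  {x | Function.Injective x}

/-- The stage `E^i`: the configurations of `n` points on the unit sphere of `ℝ^i` all of whose
mutual distances are equal to `δ`. It carries the subspace topology. -/
def levelSet (n : ℕ) (δ : ℝ) (i : ℕ) : Set (Fin n → EuclideanSpace ℝ (Fin i)) :=
  {x | x ∈ confSpace n i ∧ (∀ k, ‖x k‖ = 1) ∧ ∀ a b, a < b → ‖x a - x b‖ = δ}

/-- The inclusion `ℝ^i → ℝ^{i+1}`, `v ↦ (v, 0)`. -/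
def appendZero {i : ℕ} (v : EuclideanSpace ℝ (Fin i)) : EuclideanSpace ℝ (Fin (i + 1)) :=
  WithLp.toLp 2 (Fin.snoc (α := fun _ => ℝ) (fun j => v j) 0)

/-- The inclusion `ℝ^i → ℝ^∞`, `v ↦ (v, 0, 0, …)`, where `ℝ^∞` is the space of finitely supported
real sequences. -/
def padZero {i : ℕ} (v : EuclideanSpace ℝ (Fin i)) : ℕ →₀ ℝ :=
  Finsupp.onFinset (Finset.range i) (fun m => if h : m < i then v ⟨m, h⟩ else 0) (by
    intro m hm
    by_contra hlt
    simp only [Finset.mem_range] at hlt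
    simp [hlt] at hm)

theorem appendZero_norm_sub {i : ℕ} (v w : EuclideanSpace ℝ (Fin i)) :
    ‖appendZero v - appendZero w‖ = ‖v - w‖ := by
  simp [EuclideanSpace.norm_eq, Fin.sum_univ_castSucc, appendZero]

theorem appendZero_norm {i : ℕ} (v : EuclideanSpace ℝ (Fin i)) :
    ‖appendZero v‖ = ‖v‖ := by
  simp [EuclideanSpace.norm_eq, Fin.sum_univ_castSucc, appendZero]

theorem appendZero_injective {i : ℕ} :
    Function.Injective (appendZero : EuclideanSpace ℝ (Fin i) → _) := by
  intro v w h
  have h' := appendZero_norm_sub v w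
  rw [h, sub_self, norm_zero] at h'
  exact sub_eq_zero.mp (norm_eq_zero.mp h'.symm)

theorem levelSet_comp_perm {n : ℕ} {δ : ℝ} {i : ℕ} (σ : Equiv.Perm (Fin n))
    {x : Fin n → EuclideanSpace ℝ (Fin i)} (hx : x ∈ levelSet n δ i) :
    x ∘ σ ∈ levelSet n δ i := by
  refine ⟨fun a b h => σ.injective (hx.1 h), fun k => hx.2.1 _, fun a b hab => ?_⟩
  rcases lt_or_gt_of_ne (σ.injective.ne hab.ne) with h | h
  · exact hx.2.2 _ _ h
  · rw [norm_sub_rev]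
    exact hx.2.2 _ _ h

/-- The inclusion `E^i → E^{i+1}`. -/
def levelIncl (n : ℕ) (δ : ℝ) (i : ℕ) (x : levelSet n δ i) : levelSet n δ (i + 1) :=
  ⟨fun k => appendZero (x.1 k),
    fun _ _ h => x.2.1 (appendZero_injective h),
    fun k => (appendZero_norm _).trans (x.2.2.1 k),
    fun a b hab => (appendZero_norm_sub _ _).trans (x.2.2.2 a b hab)⟩

/-- The right action of `Sym(n)` on `E^i` by permuting the labels, `x · σ = x ∘ σ`
(a right action is a left action of the opposite group). -/
instance levelAction (n : ℕ) (δ : ℝ) (i : ℕ) :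
    MulAction (Equiv.Perm (Fin n))ᵐᵒᵖ (levelSet n δ i) where
  smul σ x := ⟨x.1 ∘ σ.unop, levelSet_comp_perm σ.unop x.2⟩
  one_smul _ := rfl
  mul_smul _ _ _ := rfl

/-- The total space: the union of the `E^i` inside `(ℝ^∞)^n`. -/
def TotalSpaceE (n : ℕ) (δ : ℝ) : Type :=
  {x : Fin n → (ℕ →₀ ℝ) // ∃ i, ∃ y ∈ levelSet n δ i, x = fun k => padZero (y k)}

/-- The inclusion of `E^i` into the total space. -/
def toTotal (n : ℕ) (δ : ℝ) (i : ℕ) (x : levelSet n δ i) : TotalSpaceE n δ :=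
  ⟨fun k => padZero (x.1 k), i, x.1, x.2, rfl⟩

/-- The total space carries the colimit (weak) topology of the `E^i`. -/
instance totalTopology (n : ℕ) (δ : ℝ) : TopologicalSpace (TotalSpaceE n δ) :=
  ⨆ i, TopologicalSpace.coinduced (toTotal n δ i) inferInstance

/-- The right action of `Sym(n)` on the total space by permuting the labels. -/
instance totalAction (n : ℕ) (δ : ℝ) :
    MulAction (Equiv.Perm (Fin n))ᵐᵒᵖ (TotalSpaceE n δ) where
  smul σ x := ⟨x.1 ∘ σ.unop, by
    obtain ⟨i, y, hy, h⟩ := x.2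
    exact ⟨i, y ∘ σ.unop, levelSet_comp_perm σ.unop hy, by rw [h]; rfl⟩⟩
  one_smul _ := rfl
  mul_smul _ _ _ := rfl

/-- `B^i = E^i / G`, with the quotient topology. -/
abbrev LevelQuot (n : ℕ) (δ : ℝ) (G : Subgroup (Equiv.Perm (Fin n))) (i : ℕ) : Type :=
  MulAction.orbitRel.Quotient G.op (levelSet n δ i)

/-- The base space, the quotient of the total space by `G`, with the quotient topology. -/
abbrev BaseSpaceB (n : ℕ) (δ : ℝ) (G : Subgroup (Equiv.Perm (Fin n))) : Type :=
  MulAction.orbitRel.Quotient G.op (TotalSpaceE n δ)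

/-- The projection `E^i → B^i`. -/
def levelProj (n : ℕ) (δ : ℝ) (G : Subgroup (Equiv.Perm (Fin n))) (i : ℕ)
    (x : levelSet n δ i) : LevelQuot n δ G i :=
  Quotient.mk _ x

/-- The projection of the total space to the base space. -/
def totalProj (n : ℕ) (δ : ℝ) (G : Subgroup (Equiv.Perm (Fin n)))
    (x : TotalSpaceE n δ) : BaseSpaceB n δ G :=
  Quotient.mk _ x

/-- The map `B^i → B^{i+1}` induced by the inclusion `E^i → E^{i+1}`. -/
def quotIncl (n : ℕ) (δ : ℝ) (G : Subgroup (Equiv.Perm (Fin n))) (i : ℕ) :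
    LevelQuot n δ G i → LevelQuot n δ G (i + 1) :=
  Quotient.map (levelIncl n δ i) (by
    rintro _ y ⟨g, rfl⟩
    exact ⟨g, rfl⟩)

/-- The map from `B^i` to the base space induced by the inclusion of `E^i`. -/
def toBase (n : ℕ) (δ : ℝ) (G : Subgroup (Equiv.Perm (Fin n))) (i : ℕ) :
    LevelQuot n δ G i → BaseSpaceB n δ G :=
  Quotient.map (toTotal n δ i) (by
    rintro _ y ⟨g, rfl⟩
    exact ⟨g, rfl⟩)

end

/-!
Every `δ` with `0 < δ < 1` works.

Unit vectors at mutual distances `δ` have Gram matrix `(1 - c) I + c J` with `c = 1 - δ² / 2`, which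
is positive definite. The stage `E^i` is therefore a level set of the map that sends an `n`-tuple of
vectors to the upper triangle of its Gram matrix, and this map is a submersion along `E^i`, since the
vectors of such a configuration are linearly independent
(`exists_surjective_hasFDerivAt_gramMap`). The inverse function theorem turns a regular level set
into a submanifold (`exists_isSubmanifoldChart_of_surjective`). A map into a submanifold is smooth if
it is smooth into the ambient space, so that the inclusions and the permutations of the labels, which
are restrictions of linear maps, are smooth. The smooth structure descends along the covering
`E^i → B^i`, as `G` acts by diffeomorphisms (`isLocalDiffeomorph_of_isPushforwardAtlas`). All
immersions are obtained from the criterion that a smooth map with injective derivative is an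
immersion (`isImmersion_of_injective_mfderiv`). The stages are compact, so that injective
continuous maps from them or from their quotients to Hausdorff spaces are closed embeddings.

The total space is contractible (`TotalSpaceE.contractibleSpace`). Linear isometries of `ℝ^∞` act on
it, and the infinite product `R_0 R_1 R_2 ⋯` of the rotations by an angle `θ` in the planes of
`e_j` and `e_{j+1}` makes sense on finitely supported sequences; it is the identity for `θ = 0` and
the shift `e_k ↦ e_{k+1}` for `θ = π / 2` (`rot`). So the identity is homotopic to any power of
the shift. After a shift by `n + 1` places, all configurations are orthogonal to a fixed configuration
`q` in the first `n + 1` coordinates, and `cos θ • x + sin θ • q` contracts them to `q`. These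
homotopies are continuous for the colimit topology because the unit interval is locally compact, so
that continuity can be tested on the products of the stages with the interval
(`TotalSpaceE.continuous_of_affine`).
-/

/-! ### Immersions from injective derivatives -/

/-- Inverse function theorem in the form of a local diffeomorphism: a function which is smooth on an
open set `U` and has invertible derivative at `a ∈ U` restricts to an `OpenPartialHomeomorph` around
`a` inside `U` which is smooth in both directions. -/
theorem exists_openPartialHomeomorph_contDiffOn {E F : Type*} [NormedAddCommGroup E]
    [NormedSpace ℝ E] [CompleteSpace E] [NormedAddCommGroup F] [NormedSpace ℝ F]
    {f : E → F} {U : Set E} (hU : IsOpen U) {a : E} (ha : a ∈ U) (hf : ContDiffOn ℝ ∞ f U)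
    (f' : E ≃L[ℝ] F) (hf' : HasFDerivAt f (f' : E →L[ℝ] F) a) :
    ∃ e : OpenPartialHomeomorph E F, a ∈ e.source ∧ e.source ⊆ U ∧ (e : E → F) = f ∧
      ContDiffOn ℝ ∞ e.symm e.target := by
  have hfa : ContDiffAt ℝ ∞ f a := hf.contDiffAt (hU.mem_nhds ha)
  have hcont : ContinuousOn (fderiv ℝ f) U := hf.continuousOn_fderiv_of_isOpen hU (by simp)
  -- invertibility of the derivative is an open condition
  have hW : IsOpen (U ∩ fderiv ℝ f ⁻¹' Set.range ((↑) : (E ≃L[ℝ] F) → E →L[ℝ] F)) :=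
    hcont.isOpen_inter_preimage hU ContinuousLinearEquiv.isOpen
  set W := U ∩ fderiv ℝ f ⁻¹' Set.range ((↑) : (E ≃L[ℝ] F) → E →L[ℝ] F)
  have haW : a ∈ W := ⟨ha, f', hf'.fderiv.symm⟩
  let e₀ := hfa.toOpenPartialHomeomorph f hf' (by simp)
  have ha₀ : a ∈ e₀.source := hfa.mem_toOpenPartialHomeomorph_source hf' (by simp)
  refine ⟨e₀.restrOpen W hW, ⟨ha₀, haW⟩, fun x hx => hx.2.1, rfl, fun y hy => ?_⟩
  set e := e₀.restrOpen W hW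
  have hx : e.symm y ∈ e₀.source ∩ W := e.map_target hy
  obtain ⟨g', hg'⟩ := hx.2.2
  have hfx : ContDiffAt ℝ ∞ f (e.symm y) := hf.contDiffAt (hU.mem_nhds hx.2.1)
  refine (e.contDiffAt_symm (f₀' := g') hy ?_ hfx).contDiffWithinAt
  change HasFDerivAt f _ _
  rw [hg']
  exact (hfx.differentiableAt (by simp)).hasFDerivAt

/-- An injective linear map between finite-dimensional spaces extends to a linear equivalence from
the sum with any space of complementary dimension. -/
theorem exists_continuousLinearEquiv_of_injective {E F K : Type*}
    [NormedAddCommGroup E] [NormedSpace ℝ E] [FiniteDimensional ℝ E]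
    [NormedAddCommGroup F] [NormedSpace ℝ F] [FiniteDimensional ℝ F]
    [NormedAddCommGroup K] [NormedSpace ℝ K] [FiniteDimensional ℝ K]
    (hd : Module.finrank ℝ E + Module.finrank ℝ K = Module.finrank ℝ F)
    (L : E →L[ℝ] F) (hL : Function.Injective L) :
    ∃ A : K →L[ℝ] F, ∃ T : (E × K) ≃L[ℝ] F, ∀ u w, T (u, w) = L u + A w := by
  obtain ⟨Q, hQ⟩ := Submodule.exists_isCompl (LinearMap.range (L : E →ₗ[ℝ] F))
  have h1 : Module.finrank ℝ (LinearMap.range (L : E →ₗ[ℝ] F)) = Module.finrank ℝ E :=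
    LinearMap.finrank_range_of_inj hL
  have h2 := Submodule.finrank_add_eq_of_isCompl hQ
  let ε : K ≃ₗ[ℝ] Q := LinearEquiv.ofFinrankEq _ _ (by omega)
  let A : K →ₗ[ℝ] F := Q.subtype ∘ₗ ε.toLinearMap
  let T₀ : (E × K) →ₗ[ℝ] F := (L : E →ₗ[ℝ] F).coprod A
  have hinj : Function.Injective T₀ := by
    rw [injective_iff_map_eq_zero]
    rintro ⟨u, w⟩ h
    have h' : L u + (ε w : F) = 0 := h
    have hu : L u = 0 := by
      refine (Submodule.disjoint_def.1 hQ.disjoint) _ ⟨u, rfl⟩ ?_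
      rw [eq_neg_of_add_eq_zero_left h']
      exact Q.neg_mem (ε w).2
    rw [hu, zero_add] at h'
    have hw : ε w = 0 := Subtype.ext h'
    exact Prod.ext (hL (by simpa using hu)) (by simpa using hw)
  let T := LinearEquiv.ofInjectiveOfFinrankEq T₀ hinj (by simpa using hd)
  exact ⟨A.toContinuousLinearMap, T.toContinuousLinearEquiv, fun u w => rfl⟩

section

variable {E : Type*} [NormedAddCommGroup E] [NormedSpace ℝ E] [FiniteDimensional ℝ E]
  {F : Type*} [NormedAddCommGroup F] [NormedSpace ℝ F] [FiniteDimensional ℝ F]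
  {M : Type*} [TopologicalSpace M] [ChartedSpace E M] [IsManifold 𝓘(ℝ, E) ∞ M]
  {N : Type*} [TopologicalSpace N] [ChartedSpace F N] [IsManifold 𝓘(ℝ, F) ∞ N]

/-- A smooth map with injective derivative at `x` is an immersion at `x`. With `g` the map in charts
and `A` a linear map onto a complement of the range of its derivative, the inverse of
`(u, w) ↦ g u + A w` straightens the chart of the target. -/
theorem isImmersionAtOfComplement_of_injective_mfderiv {K : Type*} [NormedAddCommGroup K]
    [NormedSpace ℝ K] [FiniteDimensional ℝ K]
    (hd : Module.finrank ℝ E + Module.finrank ℝ K = Module.finrank ℝ F)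
    {f : M → N} (hf : ContMDiff 𝓘(ℝ, E) 𝓘(ℝ, F) ∞ f) (x : M)
    (hx : Function.Injective (mfderiv 𝓘(ℝ, E) 𝓘(ℝ, F) f x)) :
    Manifold.IsImmersionAtOfComplement K 𝓘(ℝ, E) 𝓘(ℝ, F) ∞ f x := by
  have : CompleteSpace E := FiniteDimensional.complete ℝ E
  have : CompleteSpace K := FiniteDimensional.complete ℝ K
  set φ := chartAt E x with hφ
  set ψ := chartAt F (f x) with hψ
  have hφx : x ∈ φ.source := mem_chart_source E x
  have hψx : f x ∈ ψ.source := mem_chart_source F (f x)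
  let g : E → F := ψ ∘ f ∘ φ.symm
  let U : Set E := φ.target ∩ φ.symm ⁻¹' (f ⁻¹' ψ.source)
  have hU : IsOpen U :=
    φ.symm.isOpen_inter_preimage (ψ.open_source.preimage hf.continuous)
  have hgU : ContDiffOn ℝ ∞ g U := by
    rw [← contMDiffOn_iff_contDiffOn]
    refine (contMDiffOn_chart (I := 𝓘(ℝ, F)) (n := ∞) (x := f x)).comp
      (hf.comp_contMDiffOn ((contMDiffOn_chart_symm (I := 𝓘(ℝ, E)) (n := ∞) (x := x)).mono ?_)) ?_
    · exact fun u hu => hu.1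
    · exact fun u hu => hu.2
  have hxU : φ x ∈ U := ⟨φ.map_source hφx, by simpa [φ.left_inv hφx] using hψx⟩
  obtain ⟨D, hgd, hD⟩ : ∃ D : E →L[ℝ] F, HasFDerivAt g D (φ x) ∧ Function.Injective D := by
    refine ⟨mfderiv 𝓘(ℝ, E) 𝓘(ℝ, F) f x, hasFDerivWithinAt_univ.1 ?_, hx⟩
    have h := ((hf x).mdifferentiableAt (by simp)).hasMFDerivAt.2
    rw [ModelWithCorners.range_eq_univ] at h
    exact h
  obtain ⟨A, T, hT⟩ := exists_continuousLinearEquiv_of_injective hd D hD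
  let Ψ : E × K → F := fun p => g p.1 + A p.2
  have hΨ : ContDiffOn ℝ ∞ Ψ (U ×ˢ Set.univ) :=
    (hgU.comp contDiffOn_fst fun p hp => hp.1).add (A.contDiff.comp contDiff_snd).contDiffOn
  have hΨ' : HasFDerivAt Ψ (T : (E × K) →L[ℝ] F) (φ x, 0) := by
    have h1 : HasFDerivAt Ψ _ (φ x, (0 : K)) :=
      (HasFDerivAt.comp (φ x, (0 : K)) (f := Prod.fst) hgd hasFDerivAt_fst).add
        (A.hasFDerivAt.comp (φ x, (0 : K)) hasFDerivAt_snd)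
    exact h1.congr_fderiv (ContinuousLinearMap.ext fun p => (hT p.1 p.2).symm)
  obtain ⟨e, hae, heU, hecoe, hesymm⟩ := exists_openPartialHomeomorph_contDiffOn
    (hU.prod isOpen_univ) (Set.mk_mem_prod hxU (Set.mem_univ (0 : K))) hΨ T hΨ'
  have he0 : ∀ u, e (u, 0) = g u := fun u => by rw [hecoe]; simp [Ψ]
  have heT : ContDiffOn ℝ ∞ e e.source := by rw [hecoe]; exact hΨ.mono heU
  -- the straightened chart of the target
  let χ : OpenPartialHomeomorph N F := ψ ≫ₕ e.symm ≫ₕ T.toHomeomorph.toOpenPartialHomeomorph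
  have hχ : χ ∈ IsManifold.maximalAtlas 𝓘(ℝ, F) ∞ N := by
    apply OpenPartialHomeomorph.mem_maximalAtlas_of_contMDiffOn
    · have h1 : ContMDiffOn 𝓘(ℝ, F) 𝓘(ℝ, F) ∞ (fun y : F => T (e.symm y)) e.target :=
        (T.contDiff.comp_contDiffOn hesymm).contMDiffOn
      refine h1.comp ((contMDiffOn_chart (I := 𝓘(ℝ, F)) (n := ∞) (x := f x)).mono ?_) ?_
      · exact fun y hy => hy.1
      · intro y hy
        simpa [χ] using hy.2
    · have h1 : ContMDiffOn 𝓘(ℝ, F) 𝓘(ℝ, F) ∞ (fun y : F => e (T.symm y)) (T.symm ⁻¹' e.source) :=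
        (heT.comp T.symm.contDiff.contDiffOn fun y hy => hy).contMDiffOn
      refine (contMDiffOn_chart_symm (I := 𝓘(ℝ, F)) (n := ∞) (x := f x)).comp (h1.mono ?_) ?_
      · intro y hy
        simpa [χ] using hy.1
      · intro y hy
        simpa [χ] using hy.2
  let s : Set E := {u | (u, (0 : K)) ∈ e.source}
  have hs : IsOpen s := e.open_source.preimage (by fun_prop)
  let V : Set M := φ.source ∩ φ ⁻¹' s
  have hV : IsOpen V := φ.isOpen_inter_preimage hs
  refine Manifold.IsImmersionAtOfComplement.mk_of_continuousAt hf.continuous.continuousAt T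
    (φ.restr V) χ ?_ ?_
    (restr_mem_maximalAtlas _ (IsManifold.chart_mem_maximalAtlas x) hV) hχ ?_
  · rw [φ.restr_source' V hV]
    exact ⟨hφx, hφx, hae⟩
  · have : ψ (f x) ∈ e.target := by
      have := e.map_source hae
      rwa [he0, show g (φ x) = ψ (f x) by simp [g, φ.left_inv hφx]] at this
    simp [χ, hψx, this]
  · intro u hu
    have hu' : u ∈ φ.target ∧ φ.symm u ∈ V := by
      simpa [OpenPartialHomeomorph.extend, hV.interior_eq] using hu
    have hus : (u, (0 : K)) ∈ e.source := by
      have := hu'.2.2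
      rwa [Set.mem_preimage, φ.right_inv hu'.1] at this
    have : e.symm (g u) = (u, 0) := by rw [← he0, e.left_inv hus]
    change T (e.symm (g u)) = T (u, 0)
    rw [this]

/-- Between finite-dimensional manifolds without boundary, a smooth map with everywhere injective
derivative is an immersion. -/
theorem isImmersion_of_injective_mfderiv
    {f : M → N} (hf : ContMDiff 𝓘(ℝ, E) 𝓘(ℝ, F) ∞ f)
    (hx : ∀ x, Function.Injective (mfderiv 𝓘(ℝ, E) 𝓘(ℝ, F) f x)) :
    Manifold.IsImmersion 𝓘(ℝ, E) 𝓘(ℝ, F) ∞ f := by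
  rcases isEmpty_or_nonempty M with hM | ⟨⟨x₀⟩⟩
  · have : Manifold.IsImmersionOfComplement (EuclideanSpace ℝ (Fin 0)) 𝓘(ℝ, E) 𝓘(ℝ, F) ∞ f :=
      fun x => hM.elim x
    exact this.isImmersion
  · have hle : Module.finrank ℝ E ≤ Module.finrank ℝ F :=
      LinearMap.finrank_le_finrank_of_injective
        (f := (mfderiv 𝓘(ℝ, E) 𝓘(ℝ, F) f x₀ : E →L[ℝ] F).toLinearMap) (hx x₀)
    have : Manifold.IsImmersionOfComplement
        (EuclideanSpace ℝ (Fin (Module.finrank ℝ F - Module.finrank ℝ E)))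
        𝓘(ℝ, E) 𝓘(ℝ, F) ∞ f := fun x =>
      isImmersionAtOfComplement_of_injective_mfderiv (by simp [hle]) hf x (hx x)
    exact this.isImmersion

end

/-! ### Submanifolds of a normed space -/

/-- A chart `e` of a subset `S` of a normed space `V` that is compatible with the smooth structure
of `V`: its inverse is smooth as a map into `V`, and `e` itself is the restriction of a smooth
function on all of `V`. -/
def IsSubmanifoldChart {V E : Type*} [NormedAddCommGroup V] [NormedSpace ℝ V]
    [NormedAddCommGroup E] [NormedSpace ℝ E] {S : Set V} (e : OpenPartialHomeomorph S E) : Prop :=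
  ContDiffOn ℝ ∞ (fun u => (e.symm u : V)) e.target ∧
    ∃ L : V → E, ContDiff ℝ ∞ L ∧ ∀ s ∈ e.source, e s = L s

/-- The charted space structure on a subset of a normed space whose atlas consists of all
submanifold charts. -/
@[reducible]
noncomputable def submanifoldChartedSpace {V E : Type*} [NormedAddCommGroup V] [NormedSpace ℝ V]
    [NormedAddCommGroup E] [NormedSpace ℝ E] {S : Set V}
    (h : ∀ x : S, ∃ e : OpenPartialHomeomorph S E, IsSubmanifoldChart e ∧ x ∈ e.source) :
    ChartedSpace E S where
  atlas := {e | IsSubmanifoldChart e}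
  chartAt x := (h x).choose
  mem_chart_source x := (h x).choose_spec.2
  chart_mem_atlas x := (h x).choose_spec.1

section

variable {V : Type*} [NormedAddCommGroup V] [NormedSpace ℝ V]
  {E : Type*} [NormedAddCommGroup E] [NormedSpace ℝ E] {S : Set V} [ChartedSpace E S]

theorem isManifold_of_isSubmanifoldChart
    (hS : ∀ e ∈ atlas E S, IsSubmanifoldChart e) : IsManifold 𝓘(ℝ, E) ∞ S := by
  refine isManifold_of_contDiffOn _ _ _ fun e e' he he' => ?_
  obtain ⟨L, hL, heL⟩ := (hS e' he').2
  have h : ContDiffOn ℝ ∞ (fun u => L (e.symm u : V)) (e.symm ≫ₕ e').source :=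
    hL.comp_contDiffOn ((hS e he).1.mono fun u hu => hu.1)
  simp only [modelWithCornersSelf_coe, modelWithCornersSelf_coe_symm, Set.range_id,
    Set.preimage_id, Set.inter_univ, Function.comp_id, Function.id_comp]
  exact h.congr fun u hu => heL _ hu.2

theorem contMDiff_val_of_isSubmanifoldChart
    (hS : ∀ e ∈ atlas E S, IsSubmanifoldChart e) :
    ContMDiff 𝓘(ℝ, E) 𝓘(ℝ, V) ∞ (Subtype.val : S → V) := by
  intro x
  rw [contMDiffAt_iff]
  refine ⟨continuous_subtype_val.continuousAt, ?_⟩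
  have h := (hS _ (chart_mem_atlas E x)).1.contDiffAt
    ((chartAt E x).open_target.mem_nhds (mem_chart_target E x))
  exact h.contDiffWithinAt

/-- A map into a submanifold is smooth if it is smooth as a map into the ambient space. -/
theorem contMDiff_of_contMDiff_val
    (hS : ∀ e ∈ atlas E S, IsSubmanifoldChart e)
    {F H : Type*} [NormedAddCommGroup F] [NormedSpace ℝ F] [TopologicalSpace H]
    {I : ModelWithCorners ℝ F H} {N : Type*} [TopologicalSpace N] [ChartedSpace H N]
    {f : N → S} (hf : ContMDiff I 𝓘(ℝ, V) ∞ (fun y => (f y : V))) :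
    ContMDiff I 𝓘(ℝ, E) ∞ f := by
  have hc : Continuous f := continuous_induced_rng.2 hf.continuous
  intro y
  rw [contMDiffAt_iff_target]
  refine ⟨hc.continuousAt, ?_⟩
  obtain ⟨L, hL, heL⟩ := (hS _ (chart_mem_atlas E (f y))).2
  have h : ContMDiffAt I 𝓘(ℝ, E) ∞ (fun z => L (f z)) y := (hL.contMDiff).contMDiffAt.comp y (hf y)
  refine h.congr_of_eventuallyEq ?_
  filter_upwards [hc.continuousAt.preimage_mem_nhds
    ((chartAt E (f y)).open_source.mem_nhds (mem_chart_source E (f y)))] with z hz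
  exact heL _ hz

/-- The derivative of the inclusion is injective, as the chart is locally a smooth function of the
inclusion. -/
theorem injective_mfderiv_val_of_isSubmanifoldChart
    (hS : ∀ e ∈ atlas E S, IsSubmanifoldChart e) (x : S) :
    Function.Injective (mfderiv 𝓘(ℝ, E) 𝓘(ℝ, V) (Subtype.val : S → V) x) := by
  have := isManifold_of_isSubmanifoldChart hS
  obtain ⟨L, hL, heL⟩ := (hS _ (chart_mem_atlas E x)).2
  have hval : MDifferentiableAt 𝓘(ℝ, E) 𝓘(ℝ, V) (Subtype.val : S → V) x :=
    (contMDiff_val_of_isSubmanifoldChart hS x).mdifferentiableAt (by simp)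
  have hLd : MDifferentiableAt 𝓘(ℝ, V) 𝓘(ℝ, E) L (x : V) :=
    (hL.contMDiff (x : V)).mdifferentiableAt (by simp)
  have hcomp := mfderiv_comp x hLd hval
  have heq : L ∘ Subtype.val =ᶠ[𝓝 x] chartAt E x := by
    filter_upwards [(chartAt E x).open_source.mem_nhds (mem_chart_source E x)] with z hz
    exact (heL z hz).symm
  rw [heq.mfderiv_eq] at hcomp
  have hinj : Function.Injective (mfderiv 𝓘(ℝ, E) 𝓘(ℝ, E) (chartAt E x) x) := by
    have h := (mdifferentiable_chart (I := 𝓘(ℝ, E)) x).mfderiv_injective (mem_chart_source E x)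
    exact h
  rw [hcomp] at hinj
  exact Function.Injective.of_comp hinj

end

/-- A regular level set of a smooth map has a submanifold chart around each regular point. -/
theorem exists_isSubmanifoldChart_of_surjective {V W E : Type*}
    [NormedAddCommGroup V] [NormedSpace ℝ V] [FiniteDimensional ℝ V]
    [NormedAddCommGroup W] [NormedSpace ℝ W] [FiniteDimensional ℝ W]
    [NormedAddCommGroup E] [NormedSpace ℝ E] [FiniteDimensional ℝ E]
    (hd : Module.finrank ℝ E + Module.finrank ℝ W = Module.finrank ℝ V)
    {S : Set V} {f : V → W} {c : W} (hS : ∀ x, x ∈ S ↔ f x = c) (hf : ContDiff ℝ ∞ f) (x : S)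
    {f' : V →L[ℝ] W} (hf' : HasFDerivAt f f' x) (hsurj : Function.Surjective f') :
    ∃ e : OpenPartialHomeomorph S E, IsSubmanifoldChart e ∧ x ∈ e.source := by
  classical
  have : CompleteSpace V := FiniteDimensional.complete ℝ V
  -- a linear projection onto the tangent space `ker f'`, identified with `E`
  let K := LinearMap.ker (f' : V →ₗ[ℝ] W)
  have hK : Module.finrank ℝ K = Module.finrank ℝ E := by
    have h1 : _ + Module.finrank ℝ K = _ :=
      LinearMap.finrank_range_add_finrank_ker (f' : V →ₗ[ℝ] W)
    have h2 : Module.finrank ℝ (LinearMap.range (f' : V →ₗ[ℝ] W)) = Module.finrank ℝ W := by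
      rw [LinearMap.range_eq_top.2 hsurj, finrank_top]
    omega
  obtain ⟨π, hπ⟩ := K.subtype.exists_leftInverse_of_injective (by simp)
  let ε : K ≃ₗ[ℝ] E := LinearEquiv.ofFinrankEq _ _ hK
  let P : V →L[ℝ] E := (ε.toLinearMap ∘ₗ π).toContinuousLinearMap
  let T₀ : V →ₗ[ℝ] E × W := (P : V →ₗ[ℝ] E).prod (f' : V →ₗ[ℝ] W)
  have hinj : Function.Injective T₀ := by
    rw [injective_iff_map_eq_zero]
    intro v hv
    have h1 : ε (π v) = 0 := congrArg Prod.fst hv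
    have h2 : f' v = 0 := congrArg Prod.snd hv
    have h3 : π v = ⟨v, h2⟩ := LinearMap.congr_fun hπ (⟨v, h2⟩ : K)
    have h4 : π v = 0 := by simpa using h1
    rw [h3] at h4
    exact congrArg Subtype.val h4
  let T : V ≃L[ℝ] E × W :=
    (LinearEquiv.ofInjectiveOfFinrankEq T₀ hinj (by simpa using hd.symm)).toContinuousLinearEquiv
  let Φ : V → E × W := fun v => (P v, f v)
  have hΦ : ContDiff ℝ ∞ Φ := P.contDiff.prodMk hf
  have hΦ' : HasFDerivAt Φ (T : V →L[ℝ] E × W) (x : V) := P.hasFDerivAt.prodMk hf'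
  obtain ⟨e, hxe, -, hecoe, hesymm⟩ := exists_openPartialHomeomorph_contDiffOn
    isOpen_univ (Set.mem_univ (x : V)) hΦ.contDiffOn T hΦ'
  have heS : ∀ s : S, e s = (P s, c) := fun s => by rw [hecoe, ← (hS s).1 s.2]
  have hmem : ∀ {u : E}, (u, c) ∈ e.target → e.symm (u, c) ∈ S := fun {u} hu => by
    have h := e.right_inv hu
    rw [hecoe] at h
    exact (hS _).2 (congrArg Prod.snd h)
  let inv : E → S := fun u => if h : e.symm (u, c) ∈ S then ⟨e.symm (u, c), h⟩ else x
  have hinv : ∀ {u : E}, (u, c) ∈ e.target → (inv u : V) = e.symm (u, c) := fun {u} hu => by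
    simp [inv, hmem hu]
  have hopen : IsOpen {u : E | (u, c) ∈ e.target} := e.open_target.preimage (by fun_prop)
  have hsmooth : ContDiffOn ℝ ∞ (fun u => (inv u : V)) {u : E | (u, c) ∈ e.target} := by
    have h1 : ContDiffOn ℝ ∞ (fun u : E => e.symm (u, c)) {u : E | (u, c) ∈ e.target} :=
      hesymm.comp (by fun_prop) fun u hu => hu
    exact h1.congr fun u hu => hinv hu
  let χ : OpenPartialHomeomorph S E :=
    { toFun := fun s => P s
      invFun := inv
      source := {s | (s : V) ∈ e.source}
      target := {u | (u, c) ∈ e.target}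
      map_source' := fun s hs => by
        have := e.map_source hs
        rwa [heS] at this
      map_target' := fun u hu => by
        have := e.map_target hu
        rwa [← hinv hu] at this
      left_inv' := fun s hs => by
        have h1 : (P s, c) ∈ e.target := by
          have := e.map_source hs
          rwa [heS] at this
        apply Subtype.ext
        rw [hinv h1, ← heS, e.left_inv hs]
      right_inv' := fun u hu => by
        have h := e.right_inv hu
        rw [hecoe, ← hinv hu] at h
        exact congrArg Prod.fst h
      open_source := e.open_source.preimage continuous_subtype_val
      open_target := hopen
      continuousOn_toFun := (P.continuous.comp continuous_subtype_val).continuousOn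
      continuousOn_invFun := by
        rw [Topology.IsInducing.subtypeVal.continuousOn_iff]
        exact hsmooth.continuousOn }
  exact ⟨χ, ⟨hsmooth, P, P.contDiff, fun s _ => rfl⟩, hxe⟩

/-! ### Quotients of manifolds along local homeomorphisms -/

/-- The charts of `Q` are obtained by composing local sections of `p : M → Q` with charts of `M`. -/
def IsPushforwardAtlas {M Q : Type*} (E : Type*) [TopologicalSpace M] [TopologicalSpace Q]
    [TopologicalSpace E] [ChartedSpace E M] [ChartedSpace E Q] (p : M → Q) : Prop :=
  ∀ e ∈ atlas E Q, ∃ s : OpenPartialHomeomorph M Q, (s : M → Q) = p ∧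
    ∃ c ∈ atlas E M, e = s.symm ≫ₕ c

theorem isPushforwardAtlas_chartedSpace {M Q E : Type*} [TopologicalSpace M] [TopologicalSpace Q]
    [TopologicalSpace E] [ChartedSpace E M] {p : M → Q} (hp : IsLocalHomeomorph p)
    (hsurj : Function.Surjective p) :
    letI := hp.chartedSpace (H := E) hsurj
    IsPushforwardAtlas E p := by
  rintro _ ⟨q, rfl⟩
  refine ⟨(hp.localInverseAt _).symm, ?_, chartAt E _, chart_mem_atlas E _, rfl⟩
  simp

section

variable {E : Type*} [NormedAddCommGroup E] [NormedSpace ℝ E]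
  {M : Type*} [TopologicalSpace M] [ChartedSpace E M]
  {Q : Type*} [TopologicalSpace Q] {p : M → Q}

/-- If smooth maps over `Q` act transitively on the fibres of `p : M → Q`, then the composition of
`p` with a local section of `p` is smooth: locally, it is one of these maps. -/
theorem contMDiffAt_symm_comp
    (hdeck : ∀ x y, p x = p y → ∃ g : M → M, ContMDiff 𝓘(ℝ, E) 𝓘(ℝ, E) ∞ g ∧ g x = y ∧
      ∀ z, p (g z) = p z)
    (s : OpenPartialHomeomorph M Q) (hs : (s : M → Q) = p) (x : M) (hx : p x ∈ s.target) :
    ContMDiffAt 𝓘(ℝ, E) 𝓘(ℝ, E) ∞ (fun z => s.symm (p z)) x := by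
  have hpx : p x = p (s.symm (p x)) := by
    rw [← hs] at hx ⊢
    exact (s.right_inv hx).symm
  obtain ⟨g, hg, hgx, hpg⟩ := hdeck x _ hpx
  refine (hg x).congr_of_eventuallyEq ?_
  have hmem : g x ∈ s.source := hgx ▸ s.map_target hx
  filter_upwards [hg.continuous.continuousAt.preimage_mem_nhds (s.open_source.mem_nhds hmem)]
    with z hz
  have : s.symm (s (g z)) = g z := s.left_inv hz
  rwa [hs, hpg] at this

variable [IsManifold 𝓘(ℝ, E) ∞ M] [ChartedSpace E Q]

theorem isManifold_of_isPushforwardAtlas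
    (hdeck : ∀ x y, p x = p y → ∃ g : M → M, ContMDiff 𝓘(ℝ, E) 𝓘(ℝ, E) ∞ g ∧ g x = y ∧
      ∀ z, p (g z) = p z)
    (hQ : IsPushforwardAtlas E p) : IsManifold 𝓘(ℝ, E) ∞ Q := by
  refine isManifold_of_contDiffOn _ _ _ fun e e' he he' => ?_
  obtain ⟨s, hs, c, hc, rfl⟩ := hQ e he
  obtain ⟨s', hs', c', hc', rfl⟩ := hQ e' he'
  simp only [modelWithCornersSelf_coe, modelWithCornersSelf_coe_symm, Set.range_id,
    Set.preimage_id, Set.inter_univ, Function.comp_id, Function.id_comp]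
  intro u hu
  have hu1 : u ∈ c.target ∧ c.symm u ∈ s.source := by simpa using hu.1
  have hu2 : s (c.symm u) ∈ s'.target ∧ s'.symm (s (c.symm u)) ∈ c'.source := by simpa using hu.2
  have h1 : ContMDiffAt 𝓘(ℝ, E) 𝓘(ℝ, E) ∞ c.symm u :=
    contMDiffAt_symm_of_mem_maximalAtlas (IsManifold.subset_maximalAtlas hc) hu1.1
  have h2 := contMDiffAt_symm_comp hdeck s' hs' (c.symm u) (by rw [← hs]; exact hu2.1)
  have h3 : ContMDiffAt 𝓘(ℝ, E) 𝓘(ℝ, E) ∞ c' (s'.symm (p (c.symm u))) :=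
    contMDiffAt_of_mem_maximalAtlas (IsManifold.subset_maximalAtlas hc')
      (by rw [← hs]; exact hu2.2)
  have h := (h3.comp (c.symm u) h2).comp u h1
  rw [contMDiffAt_iff_contDiffAt] at h
  refine ContDiffAt.contDiffWithinAt (h.congr_of_eventuallyEq (Filter.Eventually.of_forall ?_))
  intro v
  simp [hs]

/-- The projection is a local diffeomorphism for the pushed forward smooth structure. -/
theorem isLocalDiffeomorph_of_isPushforwardAtlas (hp : IsLocalHomeomorph p)
    (hdeck : ∀ x y, p x = p y → ∃ g : M → M, ContMDiff 𝓘(ℝ, E) 𝓘(ℝ, E) ∞ g ∧ g x = y ∧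
      ∀ z, p (g z) = p z)
    (hQ : IsPushforwardAtlas E p) : IsLocalDiffeomorph 𝓘(ℝ, E) 𝓘(ℝ, E) ∞ p := by
  have : IsManifold 𝓘(ℝ, E) ∞ Q := isManifold_of_isPushforwardAtlas hdeck hQ
  intro x
  obtain ⟨t, hxt, ht⟩ := hp x
  refine ⟨⟨t.toPartialEquiv, t.open_source, t.open_target, ?_, ?_⟩, hxt, fun z _ => by
    rw [ht]; rfl⟩
  · intro z hz
    change ContMDiffWithinAt _ _ _ t _ _
    apply ContMDiffAt.contMDiffWithinAt
    rw [← ht]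
    obtain ⟨s, hs, c, hc, hsc⟩ := hQ _ (chart_mem_atlas E (p z))
    have hz' : p z ∈ (s.symm ≫ₕ c).source := hsc ▸ mem_chart_source E (p z)
    rw [contMDiffAt_iff_target]
    refine ⟨hp.continuous.continuousAt, ?_⟩
    have h2 := contMDiffAt_symm_comp hdeck s hs z hz'.1
    have h3 : ContMDiffAt 𝓘(ℝ, E) 𝓘(ℝ, E) ∞ c (s.symm (p z)) :=
      contMDiffAt_of_mem_maximalAtlas (IsManifold.subset_maximalAtlas hc) hz'.2
    refine (h3.comp z h2).congr_of_eventuallyEq (Filter.Eventually.of_forall fun w => ?_)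
    simp [extChartAt, OpenPartialHomeomorph.extend, hsc]
  · intro b hb
    change ContMDiffWithinAt _ _ _ t.symm _ _
    apply ContMDiffAt.contMDiffWithinAt
    obtain ⟨s, hs, c, hc, hsc⟩ := hQ _ (chart_mem_atlas E b)
    have hb' : b ∈ (s.symm ≫ₕ c).source := hsc ▸ mem_chart_source E b
    have hbs : p (s.symm b) = b := by rw [← hs]; exact s.right_inv hb'.1
    have h1 : ContMDiffAt 𝓘(ℝ, E) 𝓘(ℝ, E) ∞ c.symm (c (s.symm b)) :=
      contMDiffAt_symm_of_mem_maximalAtlas (IsManifold.subset_maximalAtlas hc)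
        (c.map_source hb'.2)
    have h2 := contMDiffAt_symm_comp hdeck t ht.symm (s.symm b) (by rwa [hbs])
    have hcc : c.symm (c (s.symm b)) = s.symm b := c.left_inv hb'.2
    rw [← hcc] at h2
    have h3 : ContMDiffAt 𝓘(ℝ, E) 𝓘(ℝ, E) ∞ (chartAt E b) b :=
      contMDiffAt_of_mem_maximalAtlas (IsManifold.chart_mem_maximalAtlas b) (mem_chart_source E b)
    have hcb : chartAt E b b = c (s.symm b) := by rw [hsc]; rfl
    rw [← hcb] at h1 h2
    refine ((h2.comp _ h1).comp b h3).congr_of_eventuallyEq ?_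
    filter_upwards [(chartAt E b).open_source.mem_nhds (mem_chart_source E b)] with w hw
    have hw' : w ∈ (s.symm ≫ₕ c).source := hsc ▸ hw
    have h4 : c.symm (c (s.symm w)) = s.symm w := c.left_inv hw'.2
    have h5 : p (s.symm w) = w := by rw [← hs]; exact s.right_inv hw'.1
    simp [hsc, h4, h5]

end

section

variable {E : Type*} [NormedAddCommGroup E] [NormedSpace ℝ E]
  {F : Type*} [NormedAddCommGroup F] [NormedSpace ℝ F]
  {M : Type*} [TopologicalSpace M] [ChartedSpace E M]
  {Q : Type*} [TopologicalSpace Q] [ChartedSpace E Q] {p : M → Q}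
  {M' : Type*} [TopologicalSpace M'] [ChartedSpace F M']
  {Q' : Type*} [TopologicalSpace Q'] [ChartedSpace F Q'] {p' : M' → Q'}

theorem contMDiff_of_isLocalDiffeomorph_comp (hp : IsLocalDiffeomorph 𝓘(ℝ, E) 𝓘(ℝ, E) ∞ p)
    (hsurj : Function.Surjective p) {h : Q → Q'}
    (hh : ContMDiff 𝓘(ℝ, E) 𝓘(ℝ, F) ∞ (h ∘ p)) : ContMDiff 𝓘(ℝ, E) 𝓘(ℝ, F) ∞ h := by
  intro b
  obtain ⟨x, rfl⟩ := hsurj b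
  have hx := hp x
  have hmem := hx.localInverse_mem_source
  have h1 : ContMDiffAt 𝓘(ℝ, E) 𝓘(ℝ, E) ∞ hx.localInverse (p x) := hx.localInverse_contMDiffAt
  have h2 := (hh (hx.localInverse (p x))).comp (p x) h1
  refine h2.congr_of_eventuallyEq ?_
  filter_upwards [hx.localInverse_eventuallyEq_right] with w hw
  exact congrArg h hw.symm

/-- A map between quotients covered by a map with injective derivative has injective derivative. -/
theorem injective_mfderiv_of_comp_isLocalDiffeomorph
    (hp : IsLocalDiffeomorph 𝓘(ℝ, E) 𝓘(ℝ, E) ∞ p) (hsurj : Function.Surjective p)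
    (hp' : IsLocalDiffeomorph 𝓘(ℝ, F) 𝓘(ℝ, F) ∞ p')
    {f : M → M'} (hf : ContMDiff 𝓘(ℝ, E) 𝓘(ℝ, F) ∞ f)
    (hfinj : ∀ x, Function.Injective (mfderiv 𝓘(ℝ, E) 𝓘(ℝ, F) f x))
    {h : Q → Q'} (hcomm : ∀ x, h (p x) = p' (f x)) (hh : ContMDiff 𝓘(ℝ, E) 𝓘(ℝ, F) ∞ h) (b : Q) :
    Function.Injective (mfderiv 𝓘(ℝ, E) 𝓘(ℝ, F) h b) := by
  obtain ⟨x, rfl⟩ := hsurj b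
  have h1 := mfderiv_comp x ((hh (p x)).mdifferentiableAt (by simp))
    ((hp.contMDiff x).mdifferentiableAt (by simp))
  have h2 := mfderiv_comp x ((hp'.contMDiff (f x)).mdifferentiableAt (by simp))
    ((hf x).mdifferentiableAt (by simp))
  rw [show h ∘ p = p' ∘ f from funext hcomm, h2] at h1
  have hpbij : Function.Surjective (mfderiv 𝓘(ℝ, E) 𝓘(ℝ, E) p x) := by
    rw [← (hp x).mfderivToContinuousLinearEquiv_coe (by simp)]
    exact ContinuousLinearEquiv.surjective _
  have hp'inj : Function.Injective (mfderiv 𝓘(ℝ, F) 𝓘(ℝ, F) p' (f x)) := by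
    rw [← (hp' (f x)).mfderivToContinuousLinearEquiv_coe (by simp)]
    exact ContinuousLinearEquiv.injective _
  intro u v huv
  obtain ⟨u, rfl⟩ := hpbij u
  obtain ⟨v, rfl⟩ := hpbij v
  have h3 := DFunLike.congr_fun h1 u
  have h4 := DFunLike.congr_fun h1 v
  have : u = v := by
    apply hfinj x
    apply hp'inj
    exact h3.trans (huv.trans h4.symm)
  rw [this]

end

/-! ### Quotients by finite groups -/

section

variable {X : Type*} [TopologicalSpace X] [T2Space X] {Γ : Type*} [Group Γ] [Finite Γ]
  [MulAction Γ X] [ContinuousConstSMul Γ X]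

/-- A free continuous action of a finite group on a Hausdorff space is a covering action: finitely
many points have pairwise disjoint neighbourhoods. -/
theorem isQuotientCoveringMap_of_finite (hfree : ∀ (g : Γ) (x : X), g • x = x → g = 1) :
    IsQuotientCoveringMap (Quotient.mk (MulAction.orbitRel Γ X)) Γ where
  __ := isQuotientMap_quotient_mk'
  continuous_const_smul := continuous_const_smul
  apply_eq_iff_mem_orbit := Quotient.eq''
  disjoint e := by
    have hsep : ∀ g : Γ, ∃ U ∈ 𝓝 e, ((g • ·) '' U ∩ U).Nonempty → g = 1 := by
      intro g
      by_cases hg : g = 1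
      · exact ⟨Set.univ, Filter.univ_mem, fun _ => hg⟩
      · obtain ⟨A, B, hA, hB, heA, heB, hAB⟩ := t2_separation (fun h => hg (hfree g e h))
        refine ⟨(g • ·) ⁻¹' A ∩ B, ?_, ?_⟩
        · exact ((hA.preimage (continuous_const_smul g)).inter hB).mem_nhds ⟨heA, heB⟩
        · rintro ⟨_, ⟨y, hy, rfl⟩, hy'⟩
          exact (Set.disjoint_left.1 hAB hy.1 hy'.2).elim
    choose U hU hUg using hsep
    refine ⟨⋂ g, U g, Filter.iInter_mem.2 hU, fun g hg => hUg g (hg.mono ?_)⟩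
    exact Set.inter_subset_inter (Set.image_mono (Set.iInter_subset U g)) (Set.iInter_subset U g)

theorem t2Space_orbitRel_quotient_of_finite : T2Space (MulAction.orbitRel.Quotient Γ X) := by
  have hopen : IsOpenMap (Quotient.mk (MulAction.orbitRel Γ X)) :=
    isOpenMap_quotient_mk'_mul
  constructor
  intro a b hab
  obtain ⟨x, rfl⟩ := Quotient.exists_rep a
  obtain ⟨y, rfl⟩ := Quotient.exists_rep b
  have hne : ∀ g : Γ, g • x ≠ y := fun g hg => hab (Quotient.sound ⟨g⁻¹, by simp [← hg]⟩)
  choose A B hA hB hxA hyB hAB using fun g => t2_separation (hne g)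
  -- saturate a neighbourhood of `x` whose translate by each `g` avoids the neighbourhood of `y`
  refine ⟨_, _, hopen _ (isOpen_iInter_of_finite fun g => (hA g).preimage (continuous_const_smul g)),
    hopen _ (isOpen_iInter_of_finite hB), ⟨x, Set.mem_iInter.2 hxA, rfl⟩,
    ⟨y, Set.mem_iInter.2 hyB, rfl⟩, ?_⟩
  rw [Set.disjoint_left]
  rintro _ ⟨u, hu, rfl⟩ ⟨v, hv, huv⟩
  obtain ⟨g, rfl⟩ : ∃ g : Γ, g • u = v := Quotient.exact huv
  exact Set.disjoint_left.1 (hAB g) (Set.mem_iInter.1 hu g) (Set.mem_iInter.1 hv g)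

end

/-! ### The inner product on finitely supported sequences -/

/-- The standard inner product on the space of finitely supported real sequences, as a bilinear
map. -/
noncomputable def seqInner : (ℕ →₀ ℝ) →ₗ[ℝ] (ℕ →₀ ℝ) →ₗ[ℝ] ℝ :=
  Finsupp.linearCombination ℝ fun m => Finsupp.lapply m

/-- The standard basis vectors of the space of finitely supported sequences. -/
noncomputable def seqBasis (m : ℕ) : ℕ →₀ ℝ := Finsupp.single m 1

@[simp]
theorem seqBasis_apply_self (m : ℕ) : seqBasis m m = 1 := by simp [seqBasis]

theorem seqBasis_apply_of_ne {m k : ℕ} (h : m ≠ k) : seqBasis m k = 0 := by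
  simp [seqBasis, h]

@[simp]
theorem seqInner_seqBasis (m : ℕ) (y : ℕ →₀ ℝ) : seqInner (seqBasis m) y = y m := by
  simp [seqInner, seqBasis]

theorem seqInner_apply (x y : ℕ →₀ ℝ) : seqInner x y = x.sum fun m r => r * y m := by
  simp [seqInner, Finsupp.linearCombination_apply, Finsupp.sum, LinearMap.sum_apply]

theorem seqInner_apply_of_subset {x : ℕ →₀ ℝ} {i : ℕ} (hx : ∀ m, i ≤ m → x m = 0) (y : ℕ →₀ ℝ) :
    seqInner x y = ∑ m ∈ Finset.range i, x m * y m := by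
  rw [seqInner_apply]
  refine Finsupp.sum_of_support_subset _ (fun m hm => ?_) _ (by simp)
  by_contra h
  exact (Finsupp.mem_support_iff.1 hm) (hx m (by simpa using h))

theorem seqInner_comm (x y : ℕ →₀ ℝ) : seqInner x y = seqInner y x := by
  obtain ⟨i, hi⟩ : ∃ i, ∀ m, i ≤ m → x m = 0 ∧ y m = 0 := by
    refine ⟨(x.support ∪ y.support).sup id + 1, fun m hm => ?_⟩
    by_contra h
    have hmem : m ∈ x.support ∪ y.support := by
      simp only [Finset.mem_union, Finsupp.mem_support_iff]
      tauto
    have := Finset.le_sup (f := id) hmem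
    simp only [id] at this
    omega
  rw [seqInner_apply_of_subset fun m hm => (hi m hm).1,
    seqInner_apply_of_subset fun m hm => (hi m hm).2]
  exact Finset.sum_congr rfl fun m _ => mul_comm _ _

/-- A linear map that preserves the inner products of basis vectors preserves all inner products. -/
theorem seqInner_map_map {A : (ℕ →₀ ℝ) →ₗ[ℝ] (ℕ →₀ ℝ)}
    (hA : ∀ j k, seqInner (A (seqBasis j)) (A (seqBasis k)) = seqInner (seqBasis j) (seqBasis k))
    (x y : ℕ →₀ ℝ) : seqInner (A x) (A y) = seqInner x y := by
  have : seqInner.compl₁₂ A A = seqInner := by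
    refine Finsupp.lhom_ext' fun j => LinearMap.ext_ring (Finsupp.lhom_ext' fun k => ?_)
    exact LinearMap.ext_ring (hA j k)
  exact LinearMap.congr_fun₂ this x y

@[simp]
theorem padZero_apply {i : ℕ} (v : EuclideanSpace ℝ (Fin i)) (m : ℕ) :
    padZero v m = if h : m < i then v ⟨m, h⟩ else 0 := rfl

theorem padZero_sub {i : ℕ} (v w : EuclideanSpace ℝ (Fin i)) :
    padZero (v - w) = padZero v - padZero w := by
  ext m
  by_cases h : m < i <;> simp [h]

theorem padZero_injective {i : ℕ} :
    Function.Injective (padZero : EuclideanSpace ℝ (Fin i) → ℕ →₀ ℝ) := by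
  intro v w h
  ext j
  have := DFunLike.congr_fun h (j : ℕ)
  simpa using this

theorem seqInner_padZero_self {i : ℕ} (v : EuclideanSpace ℝ (Fin i)) :
    seqInner (padZero v) (padZero v) = ‖v‖ ^ 2 := by
  rw [seqInner_apply_of_subset (i := i) (fun m hm => by simp [hm]), EuclideanSpace.norm_sq_eq,
    Finset.sum_range]
  refine Finset.sum_congr rfl fun j _ => ?_
  simp [sq]

theorem padZero_eq_sum {i : ℕ} (v : EuclideanSpace ℝ (Fin i)) :
    padZero v = ∑ j : Fin i, v j • seqBasis j := by
  ext m
  rw [Finsupp.finsetSum_apply]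
  by_cases h : m < i
  · rw [Finset.sum_eq_single ⟨m, h⟩]
    · simp [h]
    · intro j _ hj
      rw [Finsupp.smul_apply, seqBasis_apply_of_ne (fun hjm => hj (Fin.ext hjm)), smul_zero]
    · simp
  · rw [Finset.sum_eq_zero]
    · simp [h]
    · intro j _
      rw [Finsupp.smul_apply, seqBasis_apply_of_ne (by omega), smul_zero]

/-- The truncation of a sequence to its first `i` terms. -/
noncomputable def truncate (i : ℕ) (x : ℕ →₀ ℝ) : EuclideanSpace ℝ (Fin i) :=
  WithLp.toLp 2 fun j => x j

theorem padZero_truncate {i : ℕ} {x : ℕ →₀ ℝ} (hx : ∀ m, i ≤ m → x m = 0) :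
    padZero (truncate i x) = x := by
  ext m
  by_cases h : m < i
  · simp [h, truncate]
  · simp [h, hx m (not_lt.1 h)]

/-! ### The topology of the total space -/

/-- The metric conditions that cut out the total space among the `n`-tuples of finitely supported
sequences. -/
def IsEquidistant {n : ℕ} (δ : ℝ) (x : Fin n → (ℕ →₀ ℝ)) : Prop :=
  (∀ k, seqInner (x k) (x k) = 1) ∧
    ∀ a b, a < b → seqInner (x a - x b) (x a - x b) = δ ^ 2

theorem injective_of_norm_sub_eq {n : ℕ} {V : Type*} [NormedAddCommGroup V] {δ : ℝ} (hδ : 0 < δ)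
    {y : Fin n → V} (hy : ∀ a b, a < b → ‖y a - y b‖ = δ) : Function.Injective y := by
  intro a b hab
  by_contra hne
  rcases lt_or_gt_of_ne hne with h | h
  · exact hδ.ne (by simpa [hab] using hy a b h)
  · exact hδ.ne (by simpa [hab] using hy b a h)

theorem mem_levelSet_iff {n i : ℕ} {δ : ℝ} (hδ : 0 < δ) {y : Fin n → EuclideanSpace ℝ (Fin i)} :
    y ∈ levelSet n δ i ↔ IsEquidistant δ fun k => padZero (y k) := by
  simp only [IsEquidistant, ← padZero_sub, seqInner_padZero_self]
  have h1 : ∀ k, ‖y k‖ ^ 2 = 1 ↔ ‖y k‖ = 1 := fun k =>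
    pow_eq_one_iff_of_nonneg (norm_nonneg _) two_ne_zero
  have h2 : ∀ a b, ‖y a - y b‖ ^ 2 = δ ^ 2 ↔ ‖y a - y b‖ = δ := fun a b =>
    sq_eq_sq₀ (norm_nonneg _) hδ.le
  simp only [h1, h2]
  exact ⟨fun h => h.2, fun h => ⟨injective_of_norm_sub_eq hδ h.2, h⟩⟩

theorem continuous_levelSet_coord {n i : ℕ} {δ : ℝ} (k : Fin n) (j : Fin i) :
    Continuous fun x : levelSet n δ i => x.1 k j :=
  (EuclideanSpace.proj (𝕜 := ℝ) j).continuous.comp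
    ((continuous_apply k).comp continuous_subtype_val)

namespace TotalSpaceE

variable {n : ℕ} {δ : ℝ}

theorem isEquidistant (hδ : 0 < δ) (x : TotalSpaceE n δ) : IsEquidistant δ x.1 := by
  obtain ⟨_, i, y, hy, rfl⟩ := x
  exact (mem_levelSet_iff hδ).1 hy

theorem exists_bound {n : ℕ} (x : Fin n → (ℕ →₀ ℝ)) : ∃ i, ∀ k m, i ≤ m → x k m = 0 := by
  refine ⟨(Finset.univ.biUnion fun k => (x k).support).sup id + 1, fun k m hm => ?_⟩
  by_contra h
  have hmem : m ∈ Finset.univ.biUnion fun k => (x k).support := by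
    simpa using ⟨k, h⟩
  have := Finset.le_sup (f := id) hmem
  simp only [id] at this
  omega

theorem truncate_mem_levelSet (hδ : 0 < δ) {x : Fin n → (ℕ →₀ ℝ)} (hx : IsEquidistant δ x) {i : ℕ}
    (hi : ∀ k m, i ≤ m → x k m = 0) : (fun k => truncate i (x k)) ∈ levelSet n δ i := by
  rw [mem_levelSet_iff hδ]
  simpa only [padZero_truncate (hi _)] using hx

/-- Points of the total space from the metric conditions. -/
def mk (hδ : 0 < δ) (x : Fin n → (ℕ →₀ ℝ)) (hx : IsEquidistant δ x) : TotalSpaceE n δ :=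
  ⟨x, by
    obtain ⟨i, hi⟩ := exists_bound x
    exact ⟨i, _, truncate_mem_levelSet hδ hx hi, funext fun k => (padZero_truncate (hi k)).symm⟩⟩

theorem continuous_toTotal (i : ℕ) : Continuous (toTotal n δ i) :=
  continuous_iSup_rng continuous_coinduced_rng

theorem isOpen_iff {U : Set (TotalSpaceE n δ)} :
    IsOpen U ↔ ∀ i, IsOpen (toTotal n δ i ⁻¹' U) := by
  simp only [isOpen_iSup_iff, isOpen_coinduced]

theorem continuous_of_comp_toTotal {Y : Type*} [TopologicalSpace Y] {f : TotalSpaceE n δ → Y}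
    (hf : ∀ i, Continuous fun x => f (toTotal n δ i x)) : Continuous f :=
  continuous_iSup_dom.2 fun i => continuous_coinduced_dom.2 (hf i)

/-- The colimit topology is compatible with products with a locally compact space. -/
theorem continuous_prod_of_comp_toTotal {T Y : Type*} [TopologicalSpace T] [LocallyCompactSpace T]
    [TopologicalSpace Y] {f : TotalSpaceE n δ → T → Y}
    (hf : ∀ i, Continuous fun p : levelSet n δ i × T => f (toTotal n δ i p.1) p.2) :
    Continuous fun p : TotalSpaceE n δ × T => f p.1 p.2 := by
  have hsec : ∀ x, Continuous (f x) := by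
    rintro ⟨_, i, y, hy, rfl⟩
    exact (hf i).comp (Continuous.prodMk_right (⟨y, hy⟩ : levelSet n δ i))
  let F : TotalSpaceE n δ → C(T, Y) := fun x => ⟨f x, hsec x⟩
  have hF : Continuous F := continuous_of_comp_toTotal fun i =>
    ContinuousMap.continuous_of_continuous_uncurry (fun x => F (toTotal n δ i x)) (hf i)
  exact ContinuousMap.continuous_uncurry_of_continuous ⟨F, hF⟩

theorem continuous_coord (k : Fin n) (m : ℕ) :
    Continuous fun x : TotalSpaceE n δ => x.1 k m := by
  refine continuous_of_comp_toTotal fun i => ?_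
  have heq : (fun x : levelSet n δ i => (toTotal n δ i x).1 k m) =
      fun x => if h : m < i then x.1 k ⟨m, h⟩ else 0 := rfl
  rw [heq]
  split_ifs with h
  · exact continuous_levelSet_coord k ⟨m, h⟩
  · exact continuous_const

instance : T2Space (TotalSpaceE n δ) := by
  refine T2Space.of_injective_continuous (f := fun x : TotalSpaceE n δ => fun k m => x.1 k m) ?_ ?_
  · intro x y h
    exact Subtype.ext (funext fun k => Finsupp.ext fun m => congrFun (congrFun h k) m)
  · exact continuous_pi fun k => continuous_pi fun m => continuous_coord k m

/-- A map into a single stage of the total space is continuous if its coordinates are. -/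
theorem continuous_of_coord (hδ : 0 < δ) {Y : Type*} [TopologicalSpace Y]
    {f : Y → TotalSpaceE n δ} (i : ℕ) (hi : ∀ y k m, i ≤ m → (f y).1 k m = 0)
    (hf : ∀ k m, Continuous fun y => (f y).1 k m) : Continuous f := by
  let g : Y → levelSet n δ i := fun y =>
    ⟨fun k => truncate i ((f y).1 k), truncate_mem_levelSet hδ ((f y).isEquidistant hδ) (hi y)⟩
  have hg : Continuous g := by
    refine continuous_induced_rng.2 (continuous_pi fun k => ?_)
    exact (PiLp.continuous_toLp 2 _).comp (continuous_pi fun j => hf k j)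
  have hfg : f = toTotal n δ i ∘ g :=
    funext fun y => Subtype.ext (funext fun k => (padZero_truncate (hi y k)).symm)
  rw [hfg]
  exact (continuous_toTotal i).comp hg

/-- A family of self-maps of the total space which is given by affine maps of the sequence space is
jointly continuous as soon as its matrix entries are continuous and its columns are locally
bounded in support. -/
theorem continuous_of_affine (hδ : 0 < δ) {T : Type*} [TopologicalSpace T] [LocallyCompactSpace T]
    {f : TotalSpaceE n δ → T → TotalSpaceE n δ}
    (A : T → (ℕ →₀ ℝ) →ₗ[ℝ] (ℕ →₀ ℝ)) (q : T → Fin n → (ℕ →₀ ℝ))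
    (hf : ∀ x t k, (f x t).1 k = A t (x.1 k) + q t k)
    (hA : ∀ j, ∃ i, ∀ t m, i ≤ m → A t (seqBasis j) m = 0)
    (hAc : ∀ j m, Continuous fun t => A t (seqBasis j) m)
    (hq : ∃ i, ∀ t k m, i ≤ m → q t k m = 0)
    (hqc : ∀ k m, Continuous fun t => q t k m) :
    Continuous fun p : TotalSpaceE n δ × T => f p.1 p.2 := by
  refine continuous_prod_of_comp_toTotal fun i => ?_
  choose b hb using hA
  obtain ⟨b', hb'⟩ := hq
  have hcoord : ∀ (p : levelSet n δ i × T) k m, (f (toTotal n δ i p.1) p.2).1 k m =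
      ∑ j : Fin i, p.1.1 k j * A p.2 (seqBasis j) m + q p.2 k m := by
    intro p k m
    rw [hf]
    change (A p.2 (padZero (p.1.1 k)) + q p.2 k) m = _
    rw [padZero_eq_sum, map_sum, Finsupp.add_apply, Finsupp.finsetSum_apply]
    simp
  refine continuous_of_coord hδ ((Finset.univ.sup fun j : Fin i => b j) + b') ?_ ?_
  · intro p k m hm
    rw [hcoord, hb' _ _ _ (by omega), add_zero]
    refine Finset.sum_eq_zero fun j _ => ?_
    have := Finset.le_sup (f := fun j : Fin i => b j) (Finset.mem_univ j)
    rw [hb j _ _ (by omega), mul_zero]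
  · intro k m
    simp only [hcoord]
    refine Continuous.add (continuous_finsetSum _ fun j _ => ?_) ((hqc k m).comp continuous_snd)
    exact ((continuous_levelSet_coord k j).comp continuous_fst).mul
      ((hAc j m).comp continuous_snd)

theorem continuous_smul (σ : (Equiv.Perm (Fin n))ᵐᵒᵖ) :
    Continuous fun x : TotalSpaceE n δ => σ • x := by
  refine continuous_of_comp_toTotal fun i => ?_
  have h : Continuous fun x : levelSet n δ i => σ • x :=
    continuous_induced_rng.2 (continuous_pi fun k =>
      (continuous_apply (σ.unop k)).comp continuous_subtype_val)
  exact (continuous_toTotal i).comp h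

end TotalSpaceE

/-! ### Contractibility of the total space -/

/-- With `R_j` the rotation `e_j ↦ c e_j + s e_{j+1}`, `e_{j+1} ↦ c e_{j+1} - s e_j`, the vector
`R_0 R_1 ⋯ R_{k-1} e_k`. -/
noncomputable def rotAux (c s : ℝ) : ℕ → (ℕ →₀ ℝ)
  | 0 => seqBasis 0
  | k + 1 => c • seqBasis (k + 1) - s • rotAux c s k

/-- The infinite product of rotations `R_0 R_1 R_2 ⋯`. It is well defined as `R_j` fixes `e_k` for
`k < j`, so that `e_k` is sent to `R_0 ⋯ R_k e_k`. -/
noncomputable def rot (c s : ℝ) : (ℕ →₀ ℝ) →ₗ[ℝ] (ℕ →₀ ℝ) :=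
  Finsupp.linearCombination ℝ fun k => s • seqBasis (k + 1) + c • rotAux c s k

theorem rot_seqBasis (c s : ℝ) (k : ℕ) :
    rot c s (seqBasis k) = s • seqBasis (k + 1) + c • rotAux c s k := by
  simp [rot, seqBasis]

theorem rotAux_apply_of_lt (c s : ℝ) {k m : ℕ} (h : k < m) : rotAux c s k m = 0 := by
  induction k with
  | zero => exact seqBasis_apply_of_ne h.ne
  | succ k ih => simp [rotAux, seqBasis_apply_of_ne h.ne, ih (by omega)]

theorem rot_seqBasis_apply_of_lt (c s : ℝ) {k m : ℕ} (h : k + 1 < m) :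
    rot c s (seqBasis k) m = 0 := by
  simp [rot_seqBasis, seqBasis_apply_of_ne h.ne, rotAux_apply_of_lt c s (show k < m by omega)]

theorem continuous_rotAux_apply {T : Type*} [TopologicalSpace T] {c s : T → ℝ} (hc : Continuous c)
    (hs : Continuous s) (k m : ℕ) : Continuous fun t => rotAux (c t) (s t) k m := by
  induction k with
  | zero => exact continuous_const
  | succ k ih =>
    simp only [rotAux, Finsupp.sub_apply, Finsupp.smul_apply, smul_eq_mul]
    exact (hc.mul continuous_const).sub (hs.mul ih)

theorem continuous_rot_seqBasis_apply {T : Type*} [TopologicalSpace T] {c s : T → ℝ}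
    (hc : Continuous c) (hs : Continuous s) (k m : ℕ) :
    Continuous fun t => rot (c t) (s t) (seqBasis k) m := by
  simp only [rot_seqBasis, Finsupp.add_apply, Finsupp.smul_apply, smul_eq_mul]
  exact (hs.mul continuous_const).add (hc.mul (continuous_rotAux_apply hc hs k m))

theorem seqInner_rotAux_self {c s : ℝ} (h : c ^ 2 + s ^ 2 = 1) (k : ℕ) :
    seqInner (rotAux c s k) (rotAux c s k) = 1 := by
  induction k with
  | zero => simp [rotAux]
  | succ k ih =>
    simp only [rotAux, map_sub, map_smul, LinearMap.sub_apply, LinearMap.smul_apply, smul_eq_mul,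
      seqInner_comm _ (seqBasis (k + 1)), seqInner_seqBasis, seqBasis_apply_self,
      rotAux_apply_of_lt c s (Nat.lt_succ_self k), ih]
    linear_combination h

theorem seqInner_rotAux_rot {c s : ℝ} (h : c ^ 2 + s ^ 2 = 1) {j k : ℕ} (hjk : j < k) :
    seqInner (rotAux c s k) (rot c s (seqBasis j)) = 0 := by
  induction k, hjk using Nat.le_induction with
  | base =>
    rw [rot_seqBasis]
    simp only [rotAux, map_sub, map_add, map_smul, LinearMap.sub_apply, LinearMap.smul_apply,
      smul_eq_mul, seqInner_comm _ (seqBasis (j + 1)), seqInner_seqBasis, seqBasis_apply_self,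
      rotAux_apply_of_lt c s (Nat.lt_succ_self j), seqInner_rotAux_self h]
    ring
  | succ k hk ih =>
    simp only [rotAux, map_sub, map_smul, LinearMap.sub_apply, LinearMap.smul_apply,
      seqInner_seqBasis, ih, rot_seqBasis_apply_of_lt c s (show j + 1 < k + 1 by omega)]
    simp

theorem seqInner_rot_rot {c s : ℝ} (h : c ^ 2 + s ^ 2 = 1) (x y : ℕ →₀ ℝ) :
    seqInner (rot c s x) (rot c s y) = seqInner x y := by
  have hlt : ∀ j k, j < k →
      seqInner (rot c s (seqBasis k)) (rot c s (seqBasis j)) = 0 := fun j k hjk => by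
    rw [rot_seqBasis c s k]
    simp only [map_add, map_smul, LinearMap.add_apply, LinearMap.smul_apply, seqInner_seqBasis,
      seqInner_rotAux_rot h hjk, rot_seqBasis_apply_of_lt c s (show j + 1 < k + 1 by omega)]
    simp
  refine seqInner_map_map (fun j k => ?_) x y
  rw [seqInner_seqBasis]
  rcases lt_trichotomy j k with hjk | rfl | hjk
  · rw [seqInner_comm, hlt j k hjk, seqBasis_apply_of_ne hjk.ne']
  · rw [rot_seqBasis]
    simp only [map_add, map_smul, LinearMap.add_apply, LinearMap.smul_apply, smul_eq_mul,
      seqInner_comm _ (seqBasis (j + 1)), seqInner_seqBasis, seqBasis_apply_self,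
      rotAux_apply_of_lt c s (Nat.lt_succ_self j), seqInner_rotAux_self h]
    linear_combination h
  · rw [hlt k j hjk, seqBasis_apply_of_ne hjk.ne]

theorem rot_one_zero : rot 1 0 = LinearMap.id := by
  have : ∀ k, rotAux 1 0 k = seqBasis k := fun k => by cases k <;> simp [rotAux]
  refine Finsupp.lhom_ext' fun k => LinearMap.ext_ring ?_
  change rot 1 0 (seqBasis k) = seqBasis k
  simp [rot_seqBasis, this]

theorem rot_zero_one_seqBasis (k : ℕ) : rot 0 1 (seqBasis k) = seqBasis (k + 1) := by
  simp [rot_seqBasis]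

theorem rot_zero_one_pow_seqBasis (N k : ℕ) :
    ((rot 0 1) ^ N) (seqBasis k) = seqBasis (k + N) := by
  induction N with
  | zero => simp
  | succ N ih => rw [pow_succ', Module.End.mul_apply, ih, rot_zero_one_seqBasis, add_assoc]

theorem seqInner_rot_pow {c s : ℝ} (h : c ^ 2 + s ^ 2 = 1) (N : ℕ) (x y : ℕ →₀ ℝ) :
    seqInner ((rot c s ^ N) x) ((rot c s ^ N) y) = seqInner x y := by
  induction N with
  | zero => simp
  | succ N ih => rw [pow_succ', Module.End.mul_apply, Module.End.mul_apply, seqInner_rot_rot h, ih]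

theorem rot_zero_one_pow_apply_of_lt {N m : ℕ} (h : m < N) (x : ℕ →₀ ℝ) :
    ((rot 0 1) ^ N) x m = 0 := by
  have : Finsupp.lapply (R := ℝ) m ∘ₗ (rot 0 1) ^ N = 0 := by
    refine Finsupp.lhom_ext' fun k => LinearMap.ext_ring ?_
    change ((rot 0 1) ^ N) (seqBasis k) m = 0
    rw [rot_zero_one_pow_seqBasis, seqBasis_apply_of_ne (by omega)]
  exact LinearMap.congr_fun this x

theorem ContinuousMap.homotopic_of_continuous {X Y : Type*} [TopologicalSpace X]
    [TopologicalSpace Y] {f : X → unitInterval → Y} (hf : Continuous fun p : X × unitInterval =>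
      f p.1 p.2) {f₀ f₁ : C(X, Y)} (h₀ : ∀ x, f x 0 = f₀ x) (h₁ : ∀ x, f x 1 = f₁ x) :
    f₀.Homotopic f₁ :=
  ⟨⟨⟨fun p => f p.2 p.1, hf.comp continuous_swap⟩, h₀, h₁⟩⟩

namespace TotalSpaceE

variable {n : ℕ} {δ : ℝ}

/-- The self-map of the total space induced by a linear isometry of the sequence space. -/
noncomputable def map (hδ : 0 < δ) (A : (ℕ →₀ ℝ) →ₗ[ℝ] (ℕ →₀ ℝ))
    (hA : ∀ x y, seqInner (A x) (A y) = seqInner x y) (x : TotalSpaceE n δ) : TotalSpaceE n δ :=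
  mk hδ (fun k => A (x.1 k)) ⟨fun k => by rw [hA, (x.isEquidistant hδ).1], fun a b hab => by
    rw [← map_sub, hA, (x.isEquidistant hδ).2 a b hab]⟩

theorem continuous_map (hδ : 0 < δ) (A : (ℕ →₀ ℝ) →ₗ[ℝ] (ℕ →₀ ℝ))
    (hA : ∀ x y, seqInner (A x) (A y) = seqInner x y) :
    Continuous (map (n := n) hδ A hA) := by
  have h := continuous_of_affine hδ (T := Unit) (f := fun x _ => map (n := n) hδ A hA x)
    (fun _ => A) (fun _ _ => 0) (fun x t k => (add_zero _).symm)
    (fun j => by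
      obtain ⟨i, hi⟩ := exists_bound fun _ : Fin 1 => A (seqBasis j)
      exact ⟨i, fun _ m hm => hi 0 m hm⟩)
    (fun _ _ => continuous_const) ⟨0, fun _ _ _ _ => rfl⟩ (fun _ _ => continuous_const)
  exact h.comp (Continuous.prodMk_left ())

/-- Rotating through the angles in `[0, π/2]` joins the identity to the shift by one. -/
theorem homotopic_id_shift (hδ : 0 < δ) :
    (ContinuousMap.id (TotalSpaceE n δ)).Homotopic
      ⟨map hδ (rot 0 1) (seqInner_rot_rot (by norm_num)), continuous_map _ _ _⟩ := by
  let c : unitInterval → ℝ := fun t => Real.cos (Real.pi / 2 * t)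
  let s : unitInterval → ℝ := fun t => Real.sin (Real.pi / 2 * t)
  have hc : Continuous c := by fun_prop
  have hs : Continuous s := by fun_prop
  have hcs : ∀ t, c t ^ 2 + s t ^ 2 = 1 := fun t => Real.cos_sq_add_sin_sq _
  let f : TotalSpaceE n δ → unitInterval → TotalSpaceE n δ :=
    fun x t => map hδ (rot (c t) (s t)) (seqInner_rot_rot (hcs t)) x
  have h := continuous_of_affine hδ (f := f)
    (fun t => rot (c t) (s t)) (fun _ _ => 0) (fun x t k => (add_zero _).symm)
    (fun j => ⟨j + 2, fun t m hm => rot_seqBasis_apply_of_lt _ _ (by omega)⟩)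
    (fun j m => continuous_rot_seqBasis_apply hc hs j m)
    ⟨0, fun _ _ _ _ => rfl⟩ (fun _ _ => continuous_const)
  refine ContinuousMap.homotopic_of_continuous (f := f) h (fun x => ?_) (fun x => ?_)
  · refine Subtype.ext (funext fun k => ?_)
    change rot (c 0) (s 0) (x.1 k) = x.1 k
    simp [c, s, rot_one_zero]
  · refine Subtype.ext (funext fun k => ?_)
    change rot (c 1) (s 1) (x.1 k) = rot 0 1 (x.1 k)
    simp [c, s]

theorem homotopic_id_shift_pow (hδ : 0 < δ) (N : ℕ) :
    (ContinuousMap.id (TotalSpaceE n δ)).Homotopic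
      ⟨map hδ (rot 0 1 ^ N) (seqInner_rot_pow (by norm_num) N), continuous_map _ _ _⟩ := by
  induction N with
  | zero => exact ContinuousMap.Homotopic.refl _
  | succ N ih =>
    have h := (homotopic_id_shift hδ).comp ih
    rw [ContinuousMap.id_comp] at h
    convert h using 1
    refine ContinuousMap.ext fun x => Subtype.ext (funext fun k => ?_)
    change (rot 0 1 ^ (N + 1)) (x.1 k) = rot 0 1 ((rot 0 1 ^ N) (x.1 k))
    rw [pow_succ', Module.End.mul_apply]

/-- Equidistant vectors in `ℝ^{n+1}`: the points `a e_k + b e_n`. -/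
theorem exists_isEquidistant (hδ : 0 < δ) (hδ1 : δ < 1) :
    ∃ q : Fin n → (ℕ →₀ ℝ), IsEquidistant δ q ∧ ∀ k m, n + 1 ≤ m → q k m = 0 := by
  obtain ⟨a, ha⟩ : ∃ a : ℝ, a ^ 2 = δ ^ 2 / 2 := ⟨√(δ ^ 2 / 2), Real.sq_sqrt (by positivity)⟩
  obtain ⟨b, hb⟩ : ∃ b : ℝ, b ^ 2 = 1 - δ ^ 2 / 2 :=
    ⟨√(1 - δ ^ 2 / 2), Real.sq_sqrt (by nlinarith)⟩
  refine ⟨fun k => a • seqBasis k + b • seqBasis n, ⟨fun k => ?_, fun i j hij => ?_⟩,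
    fun k m hm => ?_⟩
  · have h1 := seqBasis_apply_of_ne k.2.ne
    have h2 := seqBasis_apply_of_ne k.2.ne'
    simp only [map_add, map_smul, LinearMap.add_apply, LinearMap.smul_apply, smul_eq_mul,
      seqInner_seqBasis, seqBasis_apply_self, h1, h2]
    linear_combination ha + hb
  · have h1 := seqBasis_apply_of_ne (fun h => hij.ne (Fin.ext h) : (i : ℕ) ≠ j)
    have h2 := seqBasis_apply_of_ne (fun h => hij.ne' (Fin.ext h) : (j : ℕ) ≠ i)
    simp only [add_sub_add_right_eq_sub, map_sub, map_smul, LinearMap.sub_apply,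
      LinearMap.smul_apply, smul_eq_mul, seqInner_seqBasis, seqBasis_apply_self, h1, h2]
    linear_combination 2 * ha
  · have hk := k.2
    simp [seqBasis_apply_of_ne (show (k : ℕ) ≠ m by omega),
      seqBasis_apply_of_ne (show n ≠ m by omega)]

/-- A configuration moved off the first `n + 1` coordinates is orthogonal to a fixed configuration
`q` in these coordinates, so that `cos θ • x + sin θ • q` stays in the total space. -/
theorem contractibleSpace (hδ : 0 < δ) (hδ1 : δ < 1) : ContractibleSpace (TotalSpaceE n δ) := by
  rw [contractible_iff_id_nullhomotopic]
  obtain ⟨q, hq, hqn⟩ := exists_isEquidistant (n := n) hδ hδ1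
  refine ⟨mk hδ q hq, (homotopic_id_shift_pow hδ (n + 1)).trans ?_⟩
  set A : (ℕ →₀ ℝ) →ₗ[ℝ] (ℕ →₀ ℝ) := rot 0 1 ^ (n + 1) with hA
  have hAA : ∀ x y, seqInner (A x) (A y) = seqInner x y := seqInner_rot_pow (by norm_num) _
  have hqA : ∀ w x, (∀ m, n + 1 ≤ m → w m = 0) → seqInner w (A x) = 0 := fun w x hw => by
    rw [seqInner_apply_of_subset hw]
    refine Finset.sum_eq_zero fun m hm => ?_
    rw [hA, rot_zero_one_pow_apply_of_lt (Finset.mem_range.1 hm), mul_zero]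
  have hcomb : ∀ (c s : ℝ) w x, (∀ m, n + 1 ≤ m → w m = 0) →
      seqInner (c • A x + s • w) (c • A x + s • w) = c ^ 2 * seqInner x x + s ^ 2 * seqInner w w :=
    fun c s w x hw => by
      simp only [map_add, map_smul, LinearMap.add_apply, LinearMap.smul_apply, smul_eq_mul, hAA,
        seqInner_comm (A x) w, hqA w x hw]
      ring
  let c : unitInterval → ℝ := fun t => Real.cos (Real.pi / 2 * t)
  let s : unitInterval → ℝ := fun t => Real.sin (Real.pi / 2 * t)
  have hc : Continuous c := by fun_prop
  have hs : Continuous s := by fun_prop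
  have hcs : ∀ t, c t ^ 2 + s t ^ 2 = 1 := fun t => Real.cos_sq_add_sin_sq _
  have hmem : ∀ (x : TotalSpaceE n δ) t, IsEquidistant δ fun k => c t • A (x.1 k) + s t • q k := by
    intro x t
    refine ⟨fun k => ?_, fun i j hij => ?_⟩
    · rw [hcomb _ _ _ _ (hqn k), (x.isEquidistant hδ).1, hq.1]
      linear_combination hcs t
    · rw [show c t • A (x.1 i) + s t • q i - (c t • A (x.1 j) + s t • q j) =
        c t • A (x.1 i - x.1 j) + s t • (q i - q j) by rw [map_sub]; module,
        hcomb _ _ _ _ (fun m hm => by rw [Finsupp.sub_apply, hqn i m hm, hqn j m hm, sub_zero]),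
        (x.isEquidistant hδ).2 i j hij, hq.2 i j hij]
      linear_combination δ ^ 2 * hcs t
  let f : TotalSpaceE n δ → unitInterval → TotalSpaceE n δ := fun x t => mk hδ _ (hmem x t)
  have h := continuous_of_affine hδ (f := f)
    (fun t => c t • A) (fun t k => s t • q k) (fun x t k => rfl)
    (fun j => ⟨j + (n + 1) + 1, fun t m hm => by
      rw [LinearMap.smul_apply, hA, rot_zero_one_pow_seqBasis, Finsupp.smul_apply,
        seqBasis_apply_of_ne (by omega), smul_zero]⟩)
    (fun j m => by
      simp only [LinearMap.smul_apply, Finsupp.smul_apply, smul_eq_mul]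
      exact hc.mul continuous_const)
    ⟨n + 1, fun t k m hm => by rw [Finsupp.smul_apply, hqn k m hm, smul_zero]⟩
    (fun k m => by
      simp only [Finsupp.smul_apply, smul_eq_mul]
      exact hs.mul continuous_const)
  refine ContinuousMap.homotopic_of_continuous (f := f) h (fun x => ?_) (fun x => ?_)
  · refine Subtype.ext (funext fun k => ?_)
    change c 0 • A (x.1 k) + s 0 • q k = A (x.1 k)
    simp [c, s]
  · refine Subtype.ext (funext fun k => ?_)
    change c 1 • A (x.1 k) + s 1 • q k = q k
    simp [c, s]

end TotalSpaceE

/-! ### The stages as regular level sets -/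

section

variable {n i : ℕ} {δ : ℝ}

theorem levelSet_inner_self {x : Fin n → EuclideanSpace ℝ (Fin i)} (hx : x ∈ levelSet n δ i)
    (k : Fin n) : inner ℝ (x k) (x k) = 1 := by
  rw [real_inner_self_eq_norm_sq, hx.2.1, one_pow]

theorem levelSet_inner_of_ne {x : Fin n → EuclideanSpace ℝ (Fin i)} (hx : x ∈ levelSet n δ i)
    {a b : Fin n} (hab : a ≠ b) : inner ℝ (x a) (x b) = 1 - δ ^ 2 / 2 := by
  have h : ‖x a - x b‖ = δ := by
    rcases lt_or_gt_of_ne hab with h | h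
    · exact hx.2.2 a b h
    · rw [norm_sub_rev]
      exact hx.2.2 b a h
  have h2 := norm_sub_sq_real (x a) (x b)
  rw [h, hx.2.1, hx.2.1] at h2
  linarith

/-- The index set of the independent entries of a symmetric `n × n` matrix. -/
abbrev UpperPair (n : ℕ) : Type := {p : Fin n × Fin n // p.1 ≤ p.2}

/-- The upper triangle of the Gram matrix of a tuple of vectors. -/
noncomputable def gramMap (n i : ℕ) (x : Fin n → EuclideanSpace ℝ (Fin i)) : UpperPair n → ℝ :=
  fun p => inner ℝ (x p.1.1) (x p.1.2)

/-- The upper triangle of the Gram matrix of unit vectors at mutual distances `δ`. -/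
noncomputable def gramValue (n : ℕ) (δ : ℝ) : UpperPair n → ℝ :=
  fun p => if p.1.1 = p.1.2 then 1 else 1 - δ ^ 2 / 2

theorem mem_levelSet_iff_gramMap (hδ : 0 < δ) (x : Fin n → EuclideanSpace ℝ (Fin i)) :
    x ∈ levelSet n δ i ↔ gramMap n i x = gramValue n δ := by
  constructor
  · intro hx
    funext ⟨⟨a, b⟩, hab⟩
    by_cases h : a = b
    · subst h
      simpa only [gramMap, gramValue, if_true] using levelSet_inner_self hx a
    · simpa only [gramMap, gramValue, h, if_false] using levelSet_inner_of_ne hx h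
  · intro h
    have h1 : ∀ k, ‖x k‖ = 1 := fun k => by
      have := congrFun h ⟨(k, k), le_rfl⟩
      simp only [gramMap, gramValue, if_true, real_inner_self_eq_norm_sq] at this
      exact (pow_eq_one_iff_of_nonneg (norm_nonneg _) two_ne_zero).1 this
    have h2 : ∀ a b, a < b → ‖x a - x b‖ = δ := fun a b hab => by
      have := congrFun h ⟨(a, b), hab.le⟩
      simp only [gramMap, gramValue, hab.ne, if_false] at this
      rw [← sq_eq_sq₀ (norm_nonneg _) hδ.le, norm_sub_sq_real, h1, h1, this]
      ring
    exact ⟨injective_of_norm_sub_eq hδ h2, h1, h2⟩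

theorem contDiff_gramMap : ContDiff ℝ ∞ (gramMap n i) :=
  contDiff_pi.2 fun p => (contDiff_apply ℝ _ p.1.1).inner ℝ (contDiff_apply ℝ _ p.1.2)

/-- The vectors of an equidistant configuration are linearly independent: their Gram matrix
`(1 - c) I + c J` with `c = 1 - δ² / 2` is invertible. Its inverse gives the solution explicitly. -/
theorem exists_inner_eq (hδ : 0 < δ) (hδ1 : δ < 1) {x : Fin n → EuclideanSpace ℝ (Fin i)}
    (hx : x ∈ levelSet n δ i) (t : Fin n → ℝ) :
    ∃ v : EuclideanSpace ℝ (Fin i), ∀ a, inner ℝ (x a) v = t a := by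
  set c : ℝ := 1 - δ ^ 2 / 2 with hc
  have hc0 : 0 < c := by nlinarith
  have hc1 : 0 < 1 - c := by
    have : 0 < δ ^ 2 := by positivity
    linarith
  have hD : 0 < 1 - c + n * c := by positivity
  set T := ∑ a, t a with hT
  let y : Fin n → ℝ := fun a => (t a - c * T / (1 - c + n * c)) / (1 - c)
  have hy : ∑ a, y a = T / (1 - c + n * c) := by
    simp only [y]
    rw [← Finset.sum_div, Finset.sum_sub_distrib, ← hT, Finset.sum_const, Finset.card_univ,
      Fintype.card_fin, nsmul_eq_mul]
    field_simp
    ring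
  refine ⟨∑ b, y b • x b, fun a => ?_⟩
  have hterm : ∀ b, inner ℝ (x a) (y b • x b) = c * y b + if a = b then (1 - c) * y a else 0 := by
    intro b
    rw [real_inner_smul_right]
    by_cases h : a = b
    · subst h
      rw [levelSet_inner_self hx, if_pos rfl]
      ring
    · rw [levelSet_inner_of_ne hx h, if_neg h]
      ring
  rw [inner_sum, Finset.sum_congr rfl fun b _ => hterm b, Finset.sum_add_distrib,
    ← Finset.mul_sum, hy, Finset.sum_ite_eq, if_pos (Finset.mem_univ a)]
  simp only [y]
  field_simp
  ring

/-- The derivative of the Gram map is surjective at an equidistant configuration `x`: the symmetric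
matrix `S` is the image of the tuple `h` with `⟪x_a, h_b⟫ = S_{ab} / 2`. -/
theorem exists_surjective_hasFDerivAt_gramMap (hδ : 0 < δ) (hδ1 : δ < 1)
    {x : Fin n → EuclideanSpace ℝ (Fin i)} (hx : x ∈ levelSet n δ i) :
    ∃ f' : (Fin n → EuclideanSpace ℝ (Fin i)) →L[ℝ] (UpperPair n → ℝ),
      HasFDerivAt (gramMap n i) f' x ∧ Function.Surjective f' := by
  have hp : ∀ k, HasFDerivAt (fun z : Fin n → EuclideanSpace ℝ (Fin i) => z k)
      (ContinuousLinearMap.proj (R := ℝ) k) x := fun k => hasFDerivAt_apply k x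
  refine ⟨_, hasFDerivAt_pi.2 fun p => (hp p.1.1).inner ℝ (hp p.1.2), fun S => ?_⟩
  have hsol := fun b : Fin n => exists_inner_eq hδ hδ1 hx
    fun a => S ⟨(min a b, max a b), min_le_max⟩ / 2
  choose h hh using hsol
  refine ⟨h, funext fun ⟨⟨a, b⟩, hab⟩ => ?_⟩
  have h1 := hh b a
  have h2 := hh a b
  simp only [min_eq_left hab, max_eq_right hab] at h1
  simp only [min_eq_right hab, max_eq_left hab] at h2
  simp only [ContinuousLinearMap.pi_apply, ContinuousLinearMap.comp_apply,
    ContinuousLinearMap.prod_apply, fderivInnerCLM_apply, ContinuousLinearMap.proj_apply]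
  rw [h1, real_inner_comm, h2]
  ring

/-- The dimension `n i - n (n + 1) / 2` of the stage `E^i` (a truncated difference, which is the
true one as soon as the stage is nonempty). -/
noncomputable def levelDim (n i : ℕ) : ℕ :=
  Module.finrank ℝ (Fin n → EuclideanSpace ℝ (Fin i)) - Module.finrank ℝ (UpperPair n → ℝ)

theorem exists_isSubmanifoldChart_levelSet (hδ : 0 < δ) (hδ1 : δ < 1) (x : levelSet n δ i) :
    ∃ e : OpenPartialHomeomorph (levelSet n δ i) (EuclideanSpace ℝ (Fin (levelDim n i))),
      IsSubmanifoldChart e ∧ x ∈ e.source := by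
  obtain ⟨f', hf', hsurj⟩ := exists_surjective_hasFDerivAt_gramMap hδ hδ1 x.2
  refine exists_isSubmanifoldChart_of_surjective ?_ (mem_levelSet_iff_gramMap hδ) contDiff_gramMap
    x hf' hsurj
  have hle := LinearMap.finrank_le_finrank_of_surjective (f := f'.toLinearMap) hsurj
  rw [finrank_euclideanSpace_fin, levelDim]
  omega

theorem compactSpace_levelSet (hδ : 0 < δ) : CompactSpace (levelSet n δ i) := by
  rw [← isCompact_iff_compactSpace]
  refine Metric.isCompact_of_isClosed_isBounded ?_ ?_
  · have : levelSet n δ i = gramMap n i ⁻¹' {gramValue n δ} :=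
      Set.ext fun x => mem_levelSet_iff_gramMap hδ x
    rw [this]
    exact isClosed_singleton.preimage contDiff_gramMap.continuous
  · refine (Metric.isBounded_closedBall (x := 0) (r := 1)).subset fun x hx => ?_
    rw [mem_closedBall_zero_iff, pi_norm_le_iff_of_nonneg zero_le_one]
    exact fun k => (hx.2.1 k).le

/-! ### The inclusions and the group action on the stages -/

/-- The inclusion `(ℝ^i)^n → (ℝ^{i+1})^n` as a continuous linear map. -/
noncomputable def appendZeroCLM (n i : ℕ) :
    (Fin n → EuclideanSpace ℝ (Fin i)) →L[ℝ] (Fin n → EuclideanSpace ℝ (Fin (i + 1))) :=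
  LinearMap.toContinuousLinearMap
    { toFun := fun x k => appendZero (x k)
      map_add' := fun x y => by
        funext k
        ext j
        refine Fin.lastCases ?_ (fun j => ?_) j <;> simp [appendZero]
      map_smul' := fun r x => by
        funext k
        ext j
        refine Fin.lastCases ?_ (fun j => ?_) j <;> simp [appendZero] }

theorem appendZeroCLM_injective : Function.Injective (appendZeroCLM n i) := fun _ _ h =>
  funext fun k => appendZero_injective (congrFun h k)

theorem levelIncl_injective : Function.Injective (levelIncl n δ i) := fun _ _ h =>
  Subtype.ext (appendZeroCLM_injective (congrArg Subtype.val h))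

theorem continuous_levelIncl : Continuous (levelIncl n δ i) :=
  continuous_induced_rng.2 ((appendZeroCLM n i).continuous.comp continuous_subtype_val)

theorem toTotal_injective : Function.Injective (toTotal n δ i) := fun _ _ h =>
  Subtype.ext (funext fun k => padZero_injective (congrFun (congrArg Subtype.val h) k))

theorem toTotal_levelIncl (x : levelSet n δ i) :
    toTotal n δ (i + 1) (levelIncl n δ i x) = toTotal n δ i x := by
  refine Subtype.ext (funext fun k => Finsupp.ext fun m => ?_)
  change padZero (appendZero (x.1 k)) m = padZero (x.1 k) m
  rcases lt_trichotomy m i with h | rfl | h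
  · rw [padZero_apply, padZero_apply, dif_pos h, dif_pos (by omega)]
    exact Fin.snoc_castSucc (α := fun _ => ℝ) _ _ ⟨m, h⟩
  · rw [padZero_apply, padZero_apply, dif_neg (lt_irrefl m), dif_pos m.lt_succ_self]
    exact Fin.snoc_last (α := fun _ => ℝ) _ _
  · rw [padZero_apply, padZero_apply, dif_neg (by omega), dif_neg (by omega)]

theorem isClosedEmbedding_toTotal (hδ : 0 < δ) : Topology.IsClosedEmbedding (toTotal n δ i) := by
  have := compactSpace_levelSet (n := n) (i := i) hδ
  exact (TotalSpaceE.continuous_toTotal i).isClosedEmbedding toTotal_injective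

theorem iUnion_range_toTotal : (⋃ i, Set.range (toTotal n δ i)) = Set.univ := by
  refine Set.eq_univ_of_forall fun x => ?_
  obtain ⟨_, i, y, hy, rfl⟩ := x
  exact Set.mem_iUnion.2 ⟨i, ⟨y, hy⟩, rfl⟩

variable (G : Subgroup (Equiv.Perm (Fin n)))

instance : Finite G.op := Finite.of_equiv G G.equivOp

theorem eq_one_of_comp_eq {X : Type*} {x : Fin n → X} (hx : Function.Injective x) (g : G.op)
    (h : x ∘ (g : (Equiv.Perm (Fin n))ᵐᵒᵖ).unop = x) : g = 1 := by
  refine Subtype.ext (MulOpposite.unop_injective (Equiv.ext fun k => ?_))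
  exact hx (congrFun h k)

theorem levelSet_smul_free (g : G.op) (x : levelSet n δ i) (h : g • x = x) : g = 1 :=
  eq_one_of_comp_eq G x.2.1 g (congrArg Subtype.val h)

theorem totalSpace_smul_free (g : G.op) (x : TotalSpaceE n δ) (h : g • x = x) : g = 1 := by
  refine eq_one_of_comp_eq G ?_ g (congrArg Subtype.val h)
  obtain ⟨_, i, y, hy, rfl⟩ := x
  exact padZero_injective.comp hy.1

instance : ContinuousConstSMul G.op (levelSet n δ i) :=
  ⟨fun g => continuous_induced_rng.2 (continuous_pi fun k =>
    (continuous_apply ((g : (Equiv.Perm (Fin n))ᵐᵒᵖ).unop k)).comp continuous_subtype_val)⟩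

instance : ContinuousConstSMul G.op (TotalSpaceE n δ) :=
  ⟨fun g => TotalSpaceE.continuous_smul (g : (Equiv.Perm (Fin n))ᵐᵒᵖ)⟩

theorem quotIncl_injective : Function.Injective (quotIncl n δ G i) := by
  intro a b
  refine Quotient.inductionOn₂ a b fun x y h => ?_
  obtain ⟨g, hg⟩ : ∃ g : G.op, g • levelIncl n δ i y = levelIncl n δ i x := Quotient.exact h
  exact Quotient.sound ⟨g, levelIncl_injective hg⟩

theorem toBase_injective : Function.Injective (toBase n δ G i) := by
  intro a b
  refine Quotient.inductionOn₂ a b fun x y h => ?_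
  obtain ⟨g, hg⟩ : ∃ g : G.op, g • toTotal n δ i y = toTotal n δ i x := Quotient.exact h
  exact Quotient.sound ⟨g, toTotal_injective hg⟩

theorem continuous_quotIncl : Continuous (quotIncl n δ G i) :=
  continuous_levelIncl.quotient_map' _

theorem continuous_toBase : Continuous (toBase n δ G i) :=
  (TotalSpaceE.continuous_toTotal i).quotient_map' _

theorem toBase_quotIncl (b : LevelQuot n δ G i) :
    toBase n δ G (i + 1) (quotIncl n δ G i b) = toBase n δ G i b :=
  Quotient.inductionOn b fun x => congrArg (totalProj n δ G) (toTotal_levelIncl x)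

theorem isClosedEmbedding_toBase (hδ : 0 < δ) : Topology.IsClosedEmbedding (toBase n δ G i) := by
  have := compactSpace_levelSet (n := n) (i := i) hδ
  have : T2Space (BaseSpaceB n δ G) := t2Space_orbitRel_quotient_of_finite
  exact (continuous_toBase G).isClosedEmbedding (toBase_injective G)

theorem iUnion_range_toBase : (⋃ i, Set.range (toBase n δ G i)) = Set.univ := by
  refine Set.eq_univ_of_forall fun b => Quotient.inductionOn b fun x => ?_
  obtain ⟨i, y, rfl⟩ := Set.mem_iUnion.1 (iUnion_range_toTotal (n := n) (δ := δ) ▸ Set.mem_univ x)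
  exact Set.mem_iUnion.2 ⟨i, levelProj n δ G i y, rfl⟩

theorem isOpen_baseSpace_iff {U : Set (BaseSpaceB n δ G)} :
    IsOpen U ↔ ∀ i, IsOpen (toBase n δ G i ⁻¹' U) := by
  rw [← isQuotientMap_quotient_mk'.isOpen_preimage, TotalSpaceE.isOpen_iff]
  exact forall_congr' fun i =>
    isQuotientMap_quotient_mk'.isOpen_preimage (s := toBase n δ G i ⁻¹' U)

end

/-! ### The smooth structures on the stages and their quotients -/

section

variable {n i : ℕ} {δ : ℝ} (G : Subgroup (Equiv.Perm (Fin n)))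

theorem isQuotientCoveringMap_levelProj :
    IsQuotientCoveringMap (levelProj n δ G i) G.op :=
  isQuotientCoveringMap_of_finite (levelSet_smul_free G)

theorem isLocalHomeomorph_levelProj : IsLocalHomeomorph (levelProj n δ G i) :=
  (isQuotientCoveringMap_levelProj G).isCoveringMap.isLocalHomeomorph

theorem levelProj_surjective : Function.Surjective (levelProj n δ G i) :=
  Quotient.mk_surjective

variable {E : Type*} [NormedAddCommGroup E] [NormedSpace ℝ E] [ChartedSpace E (levelSet n δ i)]

theorem contMDiff_smul_levelSet (h : ∀ e ∈ atlas E (levelSet n δ i), IsSubmanifoldChart e)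
    (g : G.op) : ContMDiff 𝓘(ℝ, E) 𝓘(ℝ, E) ∞ fun x : levelSet n δ i => g • x := by
  refine contMDiff_of_contMDiff_val h ?_
  have h1 : ContDiff ℝ ∞ fun v : Fin n → EuclideanSpace ℝ (Fin i) =>
      v ∘ (g : (Equiv.Perm (Fin n))ᵐᵒᵖ).unop :=
    contDiff_pi.2 fun k => contDiff_apply ℝ _ _
  exact h1.contMDiff.comp (contMDiff_val_of_isSubmanifoldChart h)

/-- The fibres of the projection to the quotient are orbits of diffeomorphisms. -/
theorem exists_contMDiff_of_levelProj_eq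
    (h : ∀ e ∈ atlas E (levelSet n δ i), IsSubmanifoldChart e) (x y : levelSet n δ i)
    (hxy : levelProj n δ G i x = levelProj n δ G i y) :
    ∃ g : levelSet n δ i → levelSet n δ i, ContMDiff 𝓘(ℝ, E) 𝓘(ℝ, E) ∞ g ∧ g x = y ∧
      ∀ z, levelProj n δ G i (g z) = levelProj n δ G i z := by
  obtain ⟨g, hg⟩ : ∃ g : G.op, g • x = y := Quotient.exact hxy.symm
  exact ⟨fun z => g • z, contMDiff_smul_levelSet G h g, hg, fun z => Quotient.sound ⟨g, rfl⟩⟩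

variable {F : Type*} [NormedAddCommGroup F] [NormedSpace ℝ F]
  [ChartedSpace F (levelSet n δ (i + 1))]

theorem contMDiff_levelIncl (h : ∀ e ∈ atlas E (levelSet n δ i), IsSubmanifoldChart e)
    (h' : ∀ e ∈ atlas F (levelSet n δ (i + 1)), IsSubmanifoldChart e) :
    ContMDiff 𝓘(ℝ, E) 𝓘(ℝ, F) ∞ (levelIncl n δ i) :=
  contMDiff_of_contMDiff_val h'
    ((appendZeroCLM n i).contMDiff.comp (contMDiff_val_of_isSubmanifoldChart h))

theorem injective_mfderiv_levelIncl (h : ∀ e ∈ atlas E (levelSet n δ i), IsSubmanifoldChart e)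
    (h' : ∀ e ∈ atlas F (levelSet n δ (i + 1)), IsSubmanifoldChart e) (x : levelSet n δ i) :
    Function.Injective (mfderiv 𝓘(ℝ, E) 𝓘(ℝ, F) (levelIncl n δ i) x) := by
  have h1 := mfderiv_comp x
    ((contMDiff_val_of_isSubmanifoldChart h' (levelIncl n δ i x)).mdifferentiableAt (by simp))
    ((contMDiff_levelIncl h h' x).mdifferentiableAt (by simp))
  have h2 := mfderiv_comp x ((appendZeroCLM n i).contMDiff (n := ∞) x.1 |>.mdifferentiableAt
    (by simp)) ((contMDiff_val_of_isSubmanifoldChart h x).mdifferentiableAt (by simp))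
  have hcomm : (Subtype.val : levelSet n δ (i + 1) → _) ∘ levelIncl n δ i =
    appendZeroCLM n i ∘ Subtype.val := rfl
  rw [hcomm, h2, ContinuousLinearMap.mfderiv_eq] at h1
  have h3 := appendZeroCLM_injective.comp (injective_mfderiv_val_of_isSubmanifoldChart h x)
  intro u v huv
  apply h3
  have hu := DFunLike.congr_fun h1 u
  have hv := DFunLike.congr_fun h1 v
  refine hu.trans (Eq.trans ?_ hv.symm)
  exact congrArg (mfderiv 𝓘(ℝ, F) 𝓘(ℝ, Fin n → EuclideanSpace ℝ (Fin (i + 1)))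
    (Subtype.val : levelSet n δ (i + 1) → _) (levelIncl n δ i x)) huv

end

theorem mainTheorem4 (n : ℕ) (G : Subgroup (Equiv.Perm (Fin n))) :
    ∃ δ : ℝ, 0 < δ ∧ δ < 1 ∧
      -- the projection of the total space to its quotient by `G` is a model of `EG → BG`:
      -- a contractible Hausdorff space with a free right `G`-action, principal over the quotient
      T2Space (TotalSpaceE n δ) ∧
      ContractibleSpace (TotalSpaceE n δ) ∧
      (∀ g : G.op, Continuous fun z : TotalSpaceE n δ => g • z) ∧
      (∀ (g : G.op) (z : TotalSpaceE n δ), g • z = z → g = 1) ∧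
      IsQuotientCoveringMap (totalProj n δ G) G.op ∧
      T2Space (BaseSpaceB n δ G) ∧
      -- the `E^i` form an exhaustive `G`-equivariant filtration of the total space,
      -- which has the colimit topology
      (∀ i (x : levelSet n δ i), toTotal n δ (i + 1) (levelIncl n δ i x) = toTotal n δ i x) ∧
      (∀ i (g : G.op) (x : levelSet n δ i), toTotal n δ i (g • x) = g • toTotal n δ i x) ∧
      (∀ i, Topology.IsClosedEmbedding (toTotal n δ i)) ∧
      (⋃ i, Set.range (toTotal n δ i)) = Set.univ ∧
      (∀ U : Set (TotalSpaceE n δ), IsOpen U ↔ ∀ i, IsOpen (toTotal n δ i ⁻¹' U)) ∧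
      -- the `B^i` form an exhaustive filtration of the base space, which has the colimit topology
      (∀ i (b : LevelQuot n δ G i), toBase n δ G (i + 1) (quotIncl n δ G i b) = toBase n δ G i b) ∧
      (∀ i, Topology.IsClosedEmbedding (toBase n δ G i)) ∧
      (⋃ i, Set.range (toBase n δ G i)) = Set.univ ∧
      (∀ U : Set (BaseSpaceB n δ G), IsOpen U ↔ ∀ i, IsOpen (toBase n δ G i ⁻¹' U)) ∧
      -- smooth structures of the same dimension `d i`, without boundary, on `E^i` and `B^i`
      ∃ (d : ℕ → ℕ)
        (_ : ∀ i, ChartedSpace (EuclideanSpace ℝ (Fin (d i))) (levelSet n δ i))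
        (_ : ∀ i, ChartedSpace (EuclideanSpace ℝ (Fin (d i))) (LevelQuot n δ G i)),
        ∀ i,
          -- `E^i` is a compact smooth manifold, embedded in `(ℝ^i)^n ⊇ Conf_n(ℝ^i)` and in
          -- `E^{i+1}`, on which `G` acts smoothly and freely
          CompactSpace (levelSet n δ i) ∧
          IsManifold (𝓡 (d i)) ∞ (levelSet n δ i) ∧
          Manifold.IsSmoothEmbedding (𝓡 (d i)) 𝓘(ℝ, Fin n → EuclideanSpace ℝ (Fin i)) ∞
            (Subtype.val : levelSet n δ i → (Fin n → EuclideanSpace ℝ (Fin i))) ∧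
          Manifold.IsSmoothEmbedding (𝓡 (d i)) (𝓡 (d (i + 1))) ∞ (levelIncl n δ i) ∧
          (∀ g : G.op, ContMDiff (𝓡 (d i)) (𝓡 (d i)) ∞ fun x : levelSet n δ i => g • x) ∧
          (∀ (g : G.op) (x : levelSet n δ i), g • x = x → g = 1) ∧
          -- `B^i` is a compact smooth manifold with the quotient smooth structure, embedded
          -- in `B^{i+1}`
          CompactSpace (LevelQuot n δ G i) ∧
          T2Space (LevelQuot n δ G i) ∧
          SecondCountableTopology (LevelQuot n δ G i) ∧
          IsManifold (𝓡 (d i)) ∞ (LevelQuot n δ G i) ∧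
          IsLocalDiffeomorph (𝓡 (d i)) (𝓡 (d i)) ∞ (levelProj n δ G i) ∧
          Manifold.IsSmoothEmbedding (𝓡 (d i)) (𝓡 (d (i + 1))) ∞ (quotIncl n δ G i) := by
  obtain ⟨δ, hδ, hδ1⟩ : ∃ δ : ℝ, 0 < δ ∧ δ < 1 := exists_between one_pos
  have hfree := totalSpace_smul_free (δ := δ) G
  refine ⟨δ, hδ, hδ1, inferInstance, TotalSpaceE.contractibleSpace hδ hδ1,
    fun g => continuous_const_smul g, hfree, isQuotientCoveringMap_of_finite hfree,
    t2Space_orbitRel_quotient_of_finite, fun i x => toTotal_levelIncl x, fun i g x => rfl,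
    fun i => isClosedEmbedding_toTotal hδ, iUnion_range_toTotal,
    fun U => TotalSpaceE.isOpen_iff, fun i b => toBase_quotIncl G b,
    fun i => isClosedEmbedding_toBase G hδ, iUnion_range_toBase G,
    fun U => isOpen_baseSpace_iff G, ?_⟩
  let cE : ∀ i, ChartedSpace (EuclideanSpace ℝ (Fin (levelDim n i))) (levelSet n δ i) := fun i =>
    submanifoldChartedSpace (exists_isSubmanifoldChart_levelSet hδ hδ1)
  let cB : ∀ i, ChartedSpace (EuclideanSpace ℝ (Fin (levelDim n i))) (LevelQuot n δ G i) := fun i =>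
    (isLocalHomeomorph_levelProj G).chartedSpace (levelProj_surjective G)
  have hE : ∀ i, ∀ e ∈ atlas (EuclideanSpace ℝ (Fin (levelDim n i))) (levelSet n δ i),
      IsSubmanifoldChart e := fun i e he => he
  have hB : ∀ i, IsPushforwardAtlas (EuclideanSpace ℝ (Fin (levelDim n i)))
      (levelProj n δ G i) := fun i =>
    isPushforwardAtlas_chartedSpace (isLocalHomeomorph_levelProj G) (levelProj_surjective G)
  have hEm : ∀ i, IsManifold (𝓡 (levelDim n i)) ∞ (levelSet n δ i) := fun i =>
    isManifold_of_isSubmanifoldChart (hE i)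
  have hBm : ∀ i, IsManifold (𝓡 (levelDim n i)) ∞ (LevelQuot n δ G i) := fun i =>
    isManifold_of_isPushforwardAtlas (exists_contMDiff_of_levelProj_eq G (hE i)) (hB i)
  have hloc : ∀ i, IsLocalDiffeomorph (𝓡 (levelDim n i)) (𝓡 (levelDim n i)) ∞
      (levelProj n δ G i) := fun i =>
    isLocalDiffeomorph_of_isPushforwardAtlas (isLocalHomeomorph_levelProj G)
      (exists_contMDiff_of_levelProj_eq G (hE i)) (hB i)
  have hEc : ∀ i, CompactSpace (levelSet n δ i) := fun i => compactSpace_levelSet hδ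
  have hBt : ∀ i, T2Space (LevelQuot n δ G i) := fun i => t2Space_orbitRel_quotient_of_finite
  have hincl : ∀ i, ContMDiff (𝓡 (levelDim n i)) (𝓡 (levelDim n (i + 1))) ∞ (levelIncl n δ i) :=
    fun i => contMDiff_levelIncl (hE i) (hE (i + 1))
  have hincl' := fun i x => injective_mfderiv_levelIncl (hE i) (hE (i + 1)) x
  have hquot : ∀ i, ContMDiff (𝓡 (levelDim n i)) (𝓡 (levelDim n (i + 1))) ∞ (quotIncl n δ G i) :=
    fun i => contMDiff_of_isLocalDiffeomorph_comp (hloc i) (levelProj_surjective G)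
      ((hloc (i + 1)).contMDiff.comp (hincl i))
  refine ⟨levelDim n, cE, cB, fun i => ⟨hEc i, hEm i, ⟨?_, Topology.IsEmbedding.subtypeVal⟩,
    ⟨?_, (continuous_levelIncl.isClosedEmbedding levelIncl_injective).isEmbedding⟩,
    contMDiff_smul_levelSet G (hE i), levelSet_smul_free G, inferInstance, hBt i,
    ContinuousConstSMul.secondCountableTopology, hBm i, hloc i, ⟨?_,
    ((continuous_quotIncl G).isClosedEmbedding (quotIncl_injective G)).isEmbedding⟩⟩⟩
  · exact isImmersion_of_injective_mfderiv (contMDiff_val_of_isSubmanifoldChart (hE i))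
      (injective_mfderiv_val_of_isSubmanifoldChart (hE i))
  · exact isImmersion_of_injective_mfderiv (hincl i) (hincl' i)
  · exact isImmersion_of_injective_mfderiv (hquot i)
      (injective_mfderiv_of_comp_isLocalDiffeomorph (hloc i) (levelProj_surjective G)
        (hloc (i + 1)) (hincl i) (hincl' i) (fun x => rfl) (hquot i))
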